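/- Let $d\ge 2$ be an integer, let $0<a_{n+1}\le a_n<1$ for all $n\ge 1$, and let $$F_n(z,w)=(z^d+q_n(z)+\delta_n w,\ \delta_n z),\qquad n\ge 1,$$ where $\delta_n\in\mathbb{C}\setminus\{0\}$ (so that $F_n$ is an automorphism of $\mathbb{C}^2$), $q_n\in\mathbb{C}[z]$ with $1\le\deg q_n\le d-1$, and $|\delta_n|$ and the moduli of all coefficients of $q_n$ are at most $a_n^{d^n}$. Then the non-autonomous basin of attraction $$\Omega=\{(z,w)\in\mathbb{C}^2:\ F_n\circ\cdots\circ F_1(z,w)\to 0 \text{ as } n\to\infty\}$$ is a Loewner Short $\mathbb{C}^2$. Here, for $k\ge2$, a set $\Omega\subseteq\mathbb{C}^k$ is a Short $\mathbb{C}^k$ if it is an increasing union of a sequence of open sets each biholomorphic to the unit ball of $\mathbb{C}^k$, its infinitesimal Kobayashi metric vanishes identically, and there is a non-constant plurisubharmonic function on $\Omega$ (with values in $[-\infty,\infty)$) that is bounded above. A Short $\mathbb{C}^k$ $\Omega$ is Loewner if there is a family of domains $(\Omega_t)_{t\ge0}$ such that 1. $\Omega=\bigcup_{t\ge0}\Omega_t$,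 and either every $\Omega_t$ is biholomorphic to the unit ball of $\mathbb{C}^k$, or every $\Omega_t$ is biholomorphic to the unit polydisc of $\mathbb{C}^k$; 2. $\Omega_t\subset\subset\Omega_s$ (that is, $\overline{\Omega}_t$ is a compact subset of $\Omega_s$) whenever $0\le t<s$; 3. $\Omega_t=\bigcup_{0\le t'<t}\Omega_{t'}$ for every $t>0$; 4. $\overline{\Omega}_{t'}=\bigcap_{t>t'}\Omega_t$ for every $t'\ge0$. -/

import Mathlib

open Set Filter Topology
open scoped ENNReal

noncomputable section

namespace LoewnerShort

/-- The complex Euclidean space of dimension `k`, with its Hermitian norm. -/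
abbrev Cn (k : ℕ) : Type := EuclideanSpace ℂ (Fin k)

/-- The open unit ball of `ℂ^k` (Euclidean norm). -/
def unitBall (k : ℕ) : Set (Cn k) := Metric.ball 0 1

/-- The open unit polydisc of `ℂ^k`. -/
def unitPolydisc (k : ℕ) : Set (Cn k) := {z | ∀ i, ‖z i‖ < 1}

/-- Two open sets of `ℂ^k` are biholomorphic: there are mutually inverse holomorphic maps. -/
def Biholomorphic {k : ℕ} (U V : Set (Cn k)) : Prop :=
  IsOpen U ∧ IsOpen V ∧ ∃ f g : Cn k → Cn k,
    DifferentiableOn ℂ f U ∧ DifferentiableOn ℂ g V ∧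
      MapsTo f U V ∧ MapsTo g V U ∧ InvOn g f U V

/-- The (infinitesimal) Kobayashi metric of `Ω` at the point `p` in the direction `ξ`: the infimum
of the `α > 0` for which some holomorphic map `f` from the unit disc to `Ω` has
`f 0 = p` and `α f'(0) = ξ`. The infimum is taken in `[0, ∞]`. -/
def kobayashiMetric {k : ℕ} (Ω : Set (Cn k)) (p ξ : Cn k) : ℝ≥0∞ :=
  ⨅ α ∈ {α : ℝ | 0 < α ∧ ∃ f : ℂ → Cn k, DifferentiableOn ℂ f (Metric.ball 0 1) ∧
      MapsTo f (Metric.ball 0 1) Ω ∧ f 0 = p ∧ (α : ℂ) • deriv f 0 = ξ}, ENNReal.ofReal α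

/-- The mean value `(1/2π) ∫ u (p + e^{iθ} ξ) dθ ∈ [-∞, ∞)` of a function `u` that is upper
semicontinuous and `< ∞` (hence bounded above) on the circle. As `u` may take the value `-∞`, the
integral is written as the limit (infimum) of the means of the truncations `max u (-n)`. -/
def circleMean {k : ℕ} (u : Cn k → EReal) (p ξ : Cn k) : EReal :=
  ⨅ n : ℕ, ((Real.circleAverage
    (fun ζ : ℂ => (max (u (p + ζ • ξ)) ((-(n : ℝ) : ℝ) : EReal)).toReal) 0 1 : ℝ) : EReal)

/-- Plurisubharmonic functions on `Ω`, with values in `[-∞, ∞)`: upper semicontinuous functions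
with the sub-mean-value property on every closed complex disc contained in `Ω`. -/
structure IsPlurisubharmonicOn {k : ℕ} (u : Cn k → EReal) (Ω : Set (Cn k)) : Prop where
  lt_top : ∀ p ∈ Ω, u p < ⊤
  usc : UpperSemicontinuousOn u Ω
  le_circleMean : ∀ p ξ : Cn k, (∀ ζ : ℂ, ‖ζ‖ ≤ 1 → p + ζ • ξ ∈ Ω) → u p ≤ circleMean u p ξ

/-- `Ω` is a Short `ℂ^k` (where `k ≥ 2`): an increasing union of biholomorphic images of the unit
ball, whose Kobayashi metric vanishes identically and which carries a non-constant plurisubharmonic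
function that is bounded above. -/
structure IsShort {k : ℕ} (Ω : Set (Cn k)) : Prop where
  two_le : 2 ≤ k
  union_balls : ∃ B : ℕ → Set (Cn k), (∀ i, Biholomorphic (B i) (unitBall k)) ∧
    (∀ i, B i ⊆ B (i + 1)) ∧ Ω = ⋃ i, B i
  kobayashi_zero : ∀ p ∈ Ω, ∀ ξ : Cn k, kobayashiMetric Ω p ξ = 0
  exists_psh : ∃ u : Cn k → EReal, IsPlurisubharmonicOn u Ω ∧
    (∃ C : ℝ, ∀ p ∈ Ω, u p ≤ (C : EReal)) ∧ ∃ p ∈ Ω, ∃ p' ∈ Ω, u p ≠ u p'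

/-- `A` is relatively compact in `B`. -/
def RelCompactIn {k : ℕ} (A B : Set (Cn k)) : Prop :=
  IsCompact (closure A) ∧ closure A ⊆ B

/-- A Short `ℂ^k` that is Loewner. Only the sets `D t` with `t ≥ 0` matter. -/
def IsLoewnerShort {k : ℕ} (Ω : Set (Cn k)) : Prop :=
  IsShort Ω ∧ ∃ D : ℝ → Set (Cn k),
    Ω = (⋃ t ∈ Ici (0 : ℝ), D t) ∧
    ((∀ t, 0 ≤ t → Biholomorphic (D t) (unitBall k)) ∨
      (∀ t, 0 ≤ t → Biholomorphic (D t) (unitPolydisc k))) ∧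
    (∀ t s, 0 ≤ t → t < s → RelCompactIn (D t) (D s)) ∧
    (∀ t, 0 < t → D t = ⋃ t' ∈ Ico 0 t, D t') ∧
    (∀ t', 0 ≤ t' → closure (D t') = ⋂ t ∈ Ioi t', D t)

/-- `compUpTo F n = F n ∘ ⋯ ∘ F 1` (the identity for `n = 0`; the map `F 0` is never used). -/
def compUpTo {X : Type*} (F : ℕ → X → X) : ℕ → X → X
  | 0 => id
  | n + 1 => F (n + 1) ∘ compUpTo F n

/-- The non-autonomous basin of attraction at the origin of the sequence `F 1, F 2, …`. -/
def basin {k : ℕ} (F : ℕ → Cn k → Cn k) : Set (Cn k) :=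
  {v | Tendsto (fun n => compUpTo F n v) atTop (𝓝 0)}

/-- The map `(z, w) ↦ (z ^ d + q z + δ w, δ z)` of `ℂ²`. -/
def henonMap (d : ℕ) (q : Polynomial ℂ) (δ : ℂ) (v : Cn 2) : Cn 2 :=
  !₂[v 0 ^ d + q.eval (v 0) + δ * v 1, δ * v 0]

end LoewnerShort

end

namespace LoewnerShort

/-! ### Sub-mean-value properties -/

/-! Put `η n = a n ^ d ^ n`. Then `η (n + 1) ≤ η n ^ d`, so the perturbations of z^d decay
superexponentially. Once (d+1) η_N ≤ 1/64, every later map sends the bidisc of radius 1/2 into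
itself, and orbits starting there shrink at least like (3/4)^k. Write (z_n, w_n) for the orbit.

Short: the basin is the increasing union of the pullbacks of the ball of radius 1/2 under late orbit
maps, which are automorphisms. A small disc about p is contracted by these maps while the target
ball stays fixed, so pulling back affine discs of that ball gives arbitrarily large discs through p
and the Kobayashi metric vanishes (`kobayashiMetric_eq_zero`). The functions d^{-n} (log (d+2) + log
max(|z_n|, |w_n|, η_n)) eventually decrease to a plurisubharmonic limit (`greenApprox_succ_le`,
`isPlurisubharmonicOn_iInf`). It is at most 0 on the basin, and `le_norm_orbit` shows that it is not
constant.

Loewner: since w_{n+1} = δ_{n+1} z_n, the set |z_n|, |z_{n+1}| < r is also the bidisc |z_{n+1}| < r,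
|w_{n+1}| < |δ_{n+1}| r. Hence it suffices to join |z_n| < r_n, |w_n| < |δ_n| r_n to |z_n|,
|z_{n+1}| < r_{n+1} by an increasing family of analytic bidiscs. The second defining function
δ_{n+1} w_n + τ (z_n^d + q_{n+1}(z_n)), for τ from 0 to 1, does this: its radius grows at rate at
least 3/8, while its value changes at rate at most 1/3 (`polydiscChain`). `PolydiscChain` glues
these pieces at integer times. -/

open Real in
-- Jensen's formula: the zeros in the closed unit disc contribute nonnegative terms.
theorem log_norm_le_circleAverage {g : ℂ → ℂ} (hg : Differentiable ℂ g) (h0 : g 0 ≠ 0) :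
    log ‖g 0‖ ≤ circleAverage (fun ζ => log ‖g ζ‖) 0 1 := by
  have han : AnalyticOnNhd ℂ g (Metric.closedBall 0 |1|) := fun z _ => hg.analyticAt z
  rw [han.circleAverage_log_norm one_ne_zero h0]
  refine le_add_of_nonneg_left (finsum_nonneg fun u => ?_)
  by_cases hu : u ∈ Metric.closedBall (0 : ℂ) |1|
  · refine mul_nonneg (mod_cast MeromorphicOn.AnalyticOnNhd.divisor_nonneg han u) ?_
    rw [abs_one, mem_closedBall_zero_iff] at hu
    rcases eq_or_ne u 0 with rfl | hu0
    · simp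
    · refine log_nonneg ?_
      rw [zero_sub, norm_neg, one_mul]
      exact (one_le_inv₀ (norm_pos_iff.2 hu0)).2 hu
  · rw [Function.locallyFinsuppWithin.apply_eq_zero_of_notMem _ hu]
    simp

open Real in
-- The lower bound 1 on the majorant covers the zeros of `g`, where `Real.log` takes the value 0
-- instead of -∞.
theorem log_norm_le_circleAverage_log {g : ℂ → ℂ} (hg : Differentiable ℂ g) (h0 : g 0 ≠ 0)
    {M : ℂ → ℝ} (hM : Continuous M) (hM1 : ∀ ζ, 1 ≤ M ζ) (hgM : ∀ ζ, ‖g ζ‖ ≤ M ζ) :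
    log ‖g 0‖ ≤ circleAverage (fun ζ => log (M ζ)) 0 1 := by
  refine (log_norm_le_circleAverage hg h0).trans (circleAverage_mono ?_ ?_ fun ζ _ => ?_)
  · exact MeromorphicOn.circleIntegrable_log_norm fun z _ => (hg.analyticAt z).meromorphicAt
  · exact ContinuousOn.circleIntegrable' (Continuous.continuousOn
      (hM.log fun ζ => (zero_lt_one.trans_le (hM1 ζ)).ne'))
  · rcases eq_or_ne (g ζ) 0 with h | h
    · simpa [h] using log_nonneg (hM1 ζ)
    · exact log_le_log (norm_pos_iff.2 h) (hgM ζ)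

/-- A continuous function that has the sub-mean-value property on all complex discs. -/
def HasSubMean {k : ℕ} (u : Cn k → ℝ) : Prop :=
  Continuous u ∧ ∀ p ξ : Cn k, u p ≤ Real.circleAverage (fun ζ : ℂ => u (p + ζ • ξ)) 0 1

open Real in
theorem hasSubMean_log_max {k : ℕ} {f g : Cn k → ℂ} (hf : Differentiable ℂ f)
    (hg : Differentiable ℂ g) {η : ℝ} (hη : 0 < η) :
    HasSubMean fun v => log (max (max ‖f v‖ ‖g v‖) η) := by
  have hpos : ∀ v, 0 < max (max ‖f v‖ ‖g v‖) η := fun v => lt_max_of_lt_right hη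
  have hcont : Continuous fun v => max (max ‖f v‖ ‖g v‖) η :=
    (hf.continuous.norm.max hg.continuous.norm).max continuous_const
  refine ⟨hcont.log fun v => (hpos v).ne', fun p ξ => ?_⟩
  have hline : Differentiable ℂ fun ζ : ℂ => p + ζ • ξ := by fun_prop
  set M : ℂ → ℝ := fun ζ => max (max ‖f (p + ζ • ξ)‖ ‖g (p + ζ • ξ)‖) η with hMdef
  have hM : Continuous M := hcont.comp hline.continuous
  have key : ∀ h : Cn k → ℂ, Differentiable ℂ h → h p ≠ 0 →
      (∀ v, ‖h v‖ ≤ max (max ‖f v‖ ‖g v‖) η) →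
      log ‖h p‖ ≤ circleAverage (fun ζ => log (M ζ)) 0 1 := by
    intro h hh h0 hle
    -- Dividing by `η` makes the majorant at least 1; the constant `log η` cancels afterwards.
    have h1 := log_norm_le_circleAverage_log (g := fun ζ => h (p + ζ • ξ) / (η : ℂ))
      ((hh.comp hline).div_const _) (by simp [h0, hη.ne']) (M := fun ζ => M ζ / η)
      (hM.div_const _) (fun ζ => (one_le_div hη).2 (le_max_right _ _))
      (fun ζ => by
        rw [norm_div, Complex.norm_real, Real.norm_of_nonneg hη.le]
        gcongr
        exact hle _)
    have h2 : (fun ζ => log (M ζ / η)) = fun ζ => log (M ζ) - log η :=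
      funext fun ζ => log_div (hpos _).ne' hη.ne'
    have h3 : CircleIntegrable (fun ζ => log (M ζ)) 0 1 :=
      ContinuousOn.circleIntegrable' (hM.log fun ζ => (hpos _).ne').continuousOn
    rw [h2, circleAverage_fun_sub h3 (circleIntegrable_const _ _ _), circleAverage_const] at h1
    simp only [zero_smul, add_zero, norm_div, Complex.norm_real, Real.norm_of_nonneg hη.le] at h1
    rw [log_div (norm_ne_zero_iff.2 h0) hη.ne'] at h1
    linarith
  -- Only the entry that realizes the maximum at `p` matters: the constant `η`, or one of the two
  -- holomorphic functions.
  by_cases hc : max ‖f p‖ ‖g p‖ ≤ η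
  · simp only [max_eq_right hc]
    rw [← circleAverage_const (log η) 0 1]
    refine circleAverage_mono (circleIntegrable_const _ _ _)
      (ContinuousOn.circleIntegrable' (hM.log fun ζ => (hpos _).ne').continuousOn) fun ζ _ => ?_
    exact log_le_log hη (le_max_right _ _)
  · push Not at hc
    simp only [max_eq_left hc.le]
    rcases le_total ‖f p‖ ‖g p‖ with h | h
    · rw [max_eq_right h] at hc ⊢
      exact key g hg (norm_pos_iff.1 (hη.trans hc))
        fun v => (le_max_right _ _).trans (le_max_left _ _)
    · rw [max_eq_left h] at hc ⊢
      exact key f hf (norm_pos_iff.1 (hη.trans hc))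
        fun v => (le_max_left _ _).trans (le_max_left _ _)

open Real in
theorem HasSubMean.const_mul_const_add {k : ℕ} {u : Cn k → ℝ} (hu : HasSubMean u) {c : ℝ}
    (hc : 0 ≤ c) (b : ℝ) : HasSubMean fun v => c * (b + u v) := by
  refine ⟨continuous_const.mul (continuous_const.add hu.1), fun p ξ => ?_⟩
  have hi : CircleIntegrable (fun ζ : ℂ => u (p + ζ • ξ)) 0 1 :=
    ContinuousOn.circleIntegrable' (hu.1.comp (by fun_prop)).continuousOn
  have h := circleAverage_fun_smul (a := c) (f := fun ζ : ℂ => b + u (p + ζ • ξ)) (c := 0) (R := 1)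
  simp only [smul_eq_mul] at h
  rw [h, circleAverage_fun_add (circleIntegrable_const _ _ _) hi, circleAverage_const]
  exact mul_le_mul_of_nonneg_left (add_le_add_right (hu.2 p ξ) b) hc

/-- Upper semicontinuity passes to infima. For the mean value, each truncation at `-m` is uniformly
bounded on the circle, so dominated convergence carries the inequality to the limit. -/
theorem isPlurisubharmonicOn_iInf {k : ℕ} {u : ℕ → Cn k → ℝ} (hu : ∀ n, HasSubMean (u n))
    (hanti : ∀ v, Antitone fun n => u n v) (Ω : Set (Cn k)) :
    IsPlurisubharmonicOn (fun v => ⨅ n, (u n v : EReal)) Ω where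
  lt_top p _ := (iInf_le _ 0).trans_lt (EReal.coe_lt_top _)
  usc := UpperSemicontinuous.upperSemicontinuousOn (upperSemicontinuous_iInf fun n =>
    (continuous_coe_real_ereal.comp (hu n).1).upperSemicontinuous) Ω
  le_circleMean p ξ _ := by
    refine le_iInf fun m => ?_
    have hline : Continuous fun ζ : ℂ => p + ζ • ξ := by fun_prop
    have hlim : Tendsto (fun n => Real.circleAverage
        (fun ζ : ℂ => max (u n (p + ζ • ξ)) (-(m : ℝ))) 0 1) atTop
        (𝓝 (Real.circleAverage (fun ζ : ℂ =>
          (max (⨅ n, (u n (p + ζ • ξ) : EReal)) ((-(m : ℝ) : ℝ) : EReal)).toReal) 0 1)) := by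
      simp only [Real.circleAverage_def]
      refine Tendsto.const_smul ?_ _
      have hc : ∀ n, Continuous fun θ : ℝ =>
          max (u n (p + circleMap 0 1 θ • ξ)) (-(m : ℝ)) := fun n =>
        (((hu n).1.comp hline).comp (continuous_circleMap 0 1)).max continuous_const
      refine intervalIntegral.tendsto_integral_filter_of_dominated_convergence
        (fun θ => max (u 0 (p + circleMap 0 1 θ • ξ)) (-(m : ℝ)) + 2 * m) ?_ ?_ ?_ ?_
      · exact .of_forall fun n => (hc n).aestronglyMeasurable
      · refine .of_forall fun n => .of_forall fun θ _ => ?_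
        have h1 : max (u n (p + circleMap 0 1 θ • ξ)) (-(m : ℝ)) ≤
            max (u 0 (p + circleMap 0 1 θ • ξ)) (-(m : ℝ)) :=
          max_le_max_right _ (hanti _ (Nat.zero_le n))
        have h2 : -(m : ℝ) ≤ max (u n (p + circleMap 0 1 θ • ξ)) (-(m : ℝ)) := le_max_right _ _
        have h3 : (0 : ℝ) ≤ m := m.cast_nonneg
        rw [Real.norm_eq_abs, abs_le]
        constructor <;> linarith
      · exact ((hc 0).add continuous_const).intervalIntegrable _ _
      · refine .of_forall fun θ _ => ?_
        set v := p + circleMap 0 1 θ • ξ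
        have h1 : Tendsto (fun n => (u n v : EReal)) atTop (𝓝 (⨅ n, (u n v : EReal))) :=
          tendsto_atTop_iInf fun i j hij => EReal.coe_le_coe_iff.2 (hanti v hij)
        have h2 := h1.max (tendsto_const_nhds (x := ((-(m : ℝ) : ℝ) : EReal)))
        have h3 := (EReal.tendsto_toReal (ne_of_lt (max_lt
            ((iInf_le (fun n => (u n v : EReal)) 0).trans_lt (EReal.coe_lt_top _))
            (EReal.coe_lt_top (-(m : ℝ)))))
          (ne_of_gt (lt_max_of_lt_right (EReal.bot_lt_coe (-(m : ℝ)))))).comp h2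
        refine h3.congr fun n => ?_
        rw [Function.comp_apply, ← EReal.coe_strictMono.monotone.map_max, EReal.toReal_coe]
    refine ge_of_tendsto ((continuous_coe_real_ereal.tendsto _).comp hlim) (.of_forall fun n => ?_)
    refine (iInf_le _ n).trans (EReal.coe_le_coe_iff.2 (((hu n).2 p ξ).trans ?_))
    refine Real.circleAverage_mono ?_ ?_ fun ζ _ => le_max_left _ _
    · exact ContinuousOn.circleIntegrable' ((hu n).1.comp hline).continuousOn
    · exact ContinuousOn.circleIntegrable'
        (((hu n).1.comp hline).max continuous_const).continuousOn

/-! ### Automorphisms of `ℂ^k` -/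

/-- Holomorphic automorphisms of `ℂ^k`. -/
def IsAut {k : ℕ} (f : Cn k → Cn k) : Prop :=
  Differentiable ℂ f ∧ ∃ g : Cn k → Cn k, Differentiable ℂ g ∧
    Function.LeftInverse g f ∧ Function.RightInverse g f

theorem isAut_id {k : ℕ} : IsAut (id : Cn k → Cn k) :=
  ⟨differentiable_id, id, differentiable_id, fun _ => rfl, fun _ => rfl⟩

theorem IsAut.comp {k : ℕ} {f₁ f₂ : Cn k → Cn k} (h₁ : IsAut f₁) (h₂ : IsAut f₂) :
    IsAut (f₁ ∘ f₂) := by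
  obtain ⟨d₁, g₁, e₁, l₁, r₁⟩ := h₁
  obtain ⟨d₂, g₂, e₂, l₂, r₂⟩ := h₂
  exact ⟨d₁.comp d₂, g₂ ∘ g₁, e₂.comp e₁, l₁.comp l₂, r₁.comp r₂⟩

theorem IsAut.biholomorphic_preimage {k : ℕ} {f : Cn k → Cn k} (hf : IsAut f) {V : Set (Cn k)}
    (hV : IsOpen V) : Biholomorphic (f ⁻¹' V) V := by
  obtain ⟨d, g, e, l, r⟩ := hf
  refine ⟨hV.preimage d.continuous, hV, f, g, d.differentiableOn, e.differentiableOn,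
    fun _ h => h, fun y hy => ?_, fun x _ => l x, fun y _ => r y⟩
  rwa [mem_preimage, r y]

theorem IsAut.exists_homeomorph {k : ℕ} {f : Cn k → Cn k} (hf : IsAut f) :
    ∃ e : Cn k ≃ₜ Cn k, ⇑e = f := by
  obtain ⟨d, g, e, l, r⟩ := hf
  exact ⟨⟨⟨f, g, l, r⟩, d.continuous, e.continuous⟩, rfl⟩

theorem IsAut.surjective {k : ℕ} {f : Cn k → Cn k} (hf : IsAut f) : Function.Surjective f := by
  obtain ⟨_, g, _, _, r⟩ := hf
  exact r.surjective

theorem isAut_compUpTo {k : ℕ} {F : ℕ → Cn k → Cn k} (hF : ∀ n, 1 ≤ n → IsAut (F n)) (n : ℕ) :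
    IsAut (compUpTo F n) := by
  induction n with
  | zero => exact isAut_id
  | succ n ih => exact (hF (n + 1) (Nat.le_add_left 1 n)).comp ih

theorem differentiable_vec2 {E : Type*} [NormedAddCommGroup E] [NormedSpace ℂ E] {f g : E → ℂ}
    (hf : Differentiable ℂ f) (hg : Differentiable ℂ g) :
    Differentiable ℂ fun v => (!₂[f v, g v] : Cn 2) := by
  rw [differentiable_euclidean]
  intro i
  fin_cases i
  · simpa using hf
  · simpa using hg

theorem vec2_ext {v v' : Cn 2} (h0 : v 0 = v' 0) (h1 : v 1 = v' 1) : v = v' := by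
  ext i
  fin_cases i
  · exact h0
  · exact h1

theorem differentiable_coord {k : ℕ} (i : Fin k) : Differentiable ℂ fun v : Cn k => v i :=
  (EuclideanSpace.proj (𝕜 := ℂ) i).differentiable

theorem norm_le_add_coord (v : Cn 2) : ‖v‖ ≤ ‖v 0‖ + ‖v 1‖ := by
  rw [EuclideanSpace.norm_eq, Fin.sum_univ_two, Real.sqrt_le_left (by positivity)]
  nlinarith [norm_nonneg (v 0), norm_nonneg (v 1)]

theorem isAut_shear {α β : ℂ} (hα : α ≠ 0) (hβ : β ≠ 0) {P : ℂ → ℂ} (hP : Differentiable ℂ P) :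
    IsAut fun v : Cn 2 => !₂[α * v 0, β * v 1 + P (v 0)] := by
  have c0 := differentiable_coord (0 : Fin 2)
  have c1 := differentiable_coord (1 : Fin 2)
  have cα : Differentiable ℂ fun v : Cn 2 => v 0 / α := by
    simpa only [div_eq_mul_inv] using c0.mul_const α⁻¹
  have cP : Differentiable ℂ fun v : Cn 2 => P (v 0 / α) := hP.comp cα
  have cβ : Differentiable ℂ fun v : Cn 2 => (v 1 - P (v 0 / α)) / β := by
    simpa only [div_eq_mul_inv] using (c1.fun_sub cP).mul_const β⁻¹
  refine ⟨differentiable_vec2 (c0.const_mul α) ((c1.const_mul β).add (hP.comp c0)),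
    fun v => !₂[v 0 / α, (v 1 - P (v 0 / α)) / β],
    differentiable_vec2 cα cβ, fun v => ?_, fun v => ?_⟩
  · refine vec2_ext ?_ ?_
    · simp [hα]
    · simp [hα, hβ]
  · refine vec2_ext ?_ ?_
    · simp [hα, mul_div_cancel₀]
    · simp [hβ, mul_div_cancel₀]

theorem isAut_swap : IsAut fun v : Cn 2 => !₂[v 1, v 0] := by
  have c0 := differentiable_coord (0 : Fin 2)
  have c1 := differentiable_coord (1 : Fin 2)
  refine ⟨differentiable_vec2 c1 c0, fun v => !₂[v 1, v 0], differentiable_vec2 c1 c0,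
    fun v => vec2_ext ?_ ?_, fun v => vec2_ext ?_ ?_⟩ <;> simp

/-- The map is the coordinate swap after the shear (z, w) ↦ (δz, δw + z^d + q(z)), invertible
because δ ≠ 0. -/
theorem isAut_henonMap (d : ℕ) (q : Polynomial ℂ) {δ : ℂ} (hδ : δ ≠ 0) :
    IsAut (henonMap d q δ) := by
  have h := isAut_swap.comp (isAut_shear hδ hδ (P := fun z => z ^ d + q.eval z)
    ((differentiable_id.pow d).add q.differentiable))
  convert h using 1
  funext v
  refine vec2_ext ?_ ?_
  · simp [henonMap]
    ring
  · simp [henonMap]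

/-! ### Polydiscs -/

/-- The closed unit polydisc of `ℂ^k`. -/
def closedUnitPolydisc (k : ℕ) : Set (Cn k) := {z | ∀ i, ‖z i‖ ≤ 1}

theorem unitPolydisc_eq (k : ℕ) : unitPolydisc k =
    (EuclideanSpace.equiv (Fin k) ℂ).toHomeomorph ⁻¹' univ.pi fun _ => Metric.ball 0 1 := by
  ext z
  simp [unitPolydisc]

theorem closedUnitPolydisc_eq (k : ℕ) : closedUnitPolydisc k =
    (EuclideanSpace.equiv (Fin k) ℂ).toHomeomorph ⁻¹'
      univ.pi fun _ => Metric.closedBall 0 1 := by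
  ext z
  simp [closedUnitPolydisc]

theorem isOpen_unitPolydisc (k : ℕ) : IsOpen (unitPolydisc k) := by
  rw [unitPolydisc_eq]
  exact (isOpen_set_pi finite_univ fun _ _ => Metric.isOpen_ball).preimage
    (Homeomorph.continuous _)

theorem isCompact_closedUnitPolydisc (k : ℕ) : IsCompact (closedUnitPolydisc k) := by
  rw [closedUnitPolydisc_eq, Homeomorph.isCompact_preimage]
  exact isCompact_univ_pi fun _ => isCompact_closedBall 0 1

theorem closure_unitPolydisc (k : ℕ) : closure (unitPolydisc k) = closedUnitPolydisc k := by
  rw [closedUnitPolydisc_eq, unitPolydisc_eq, ← Homeomorph.preimage_closure, closure_pi_set]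
  simp only [closure_ball (0 : ℂ) one_ne_zero]

theorem IsAut.closure_preimage {k : ℕ} {f : Cn k → Cn k} (hf : IsAut f) :
    closure (f ⁻¹' unitPolydisc k) = f ⁻¹' closedUnitPolydisc k := by
  obtain ⟨e, rfl⟩ := hf.exists_homeomorph
  rw [← e.preimage_closure, closure_unitPolydisc]

theorem IsAut.isCompact_preimage {k : ℕ} {f : Cn k → Cn k} (hf : IsAut f) :
    IsCompact (f ⁻¹' closedUnitPolydisc k) := by
  obtain ⟨e, rfl⟩ := hf.exists_homeomorph
  exact e.isCompact_preimage.2 (isCompact_closedUnitPolydisc k)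

/-! ### Gluing Loewner chains of polydiscs -/

/-- A sequence of continuous chains of analytic polydiscs, each parametrized by `[0, 1]` and
ending where the next one starts. -/
structure PolydiscChain {k : ℕ} (T : ℕ → ℝ → Cn k → Cn k) : Prop where
  isAut : ∀ n, ∀ τ ∈ Icc (0 : ℝ) 1, IsAut (T n τ)
  continuousOn : ∀ n v, ContinuousOn (fun τ => T n τ v) (Icc 0 1)
  glue : ∀ n, T n 1 ⁻¹' unitPolydisc k = T (n + 1) 0 ⁻¹' unitPolydisc k
  subset : ∀ n τ σ, 0 ≤ τ → τ < σ → σ ≤ 1 →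
    T n τ ⁻¹' closedUnitPolydisc k ⊆ T n σ ⁻¹' unitPolydisc k

/-- The members of a sequence of chains, parametrized by `[0, ∞)`. -/
def chainSet {k : ℕ} (T : ℕ → ℝ → Cn k → Cn k) (t : ℝ) : Set (Cn k) :=
  T ⌊t⌋₊ (t - ⌊t⌋₊) ⁻¹' unitPolydisc k

namespace PolydiscChain

variable {k : ℕ} {T : ℕ → ℝ → Cn k → Cn k}

/-- Allowing the right endpoint, where the floor has already jumped to `n + 1`, is what `glue`
provides; later arguments can then stay within one piece on a closed interval. -/
theorem chainSet_eq (hT : PolydiscChain T) {n : ℕ} {t : ℝ} (h1 : (n : ℝ) ≤ t) (h2 : t ≤ n + 1) :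
    chainSet T t = T n (t - n) ⁻¹' unitPolydisc k := by
  rcases h2.lt_or_eq with h | rfl
  · have : ⌊t⌋₊ = n := (Nat.floor_eq_iff (n.cast_nonneg.trans h1)).2 ⟨h1, h⟩
    rw [chainSet, this]
  · have : ⌊(n : ℝ) + 1⌋₊ = n + 1 := by exact_mod_cast Nat.floor_natCast (R := ℝ) (n + 1)
    rw [chainSet, this]
    push_cast
    rw [sub_self, add_sub_cancel_left, hT.glue]

theorem closure_chainSet (hT : PolydiscChain T) {n : ℕ} {t : ℝ} (h1 : (n : ℝ) ≤ t)
    (h2 : t ≤ n + 1) : closure (chainSet T t) = T n (t - n) ⁻¹' closedUnitPolydisc k := by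
  rw [hT.chainSet_eq h1 h2]
  exact (hT.isAut n _ ⟨by linarith, by linarith⟩).closure_preimage

theorem closure_subset_of_le (hT : PolydiscChain T) {n : ℕ} {t s : ℝ} (h1 : (n : ℝ) ≤ t)
    (hts : t < s) (h2 : s ≤ n + 1) : closure (chainSet T t) ⊆ chainSet T s := by
  rw [hT.closure_chainSet h1 (hts.le.trans h2), hT.chainSet_eq (h1.trans hts.le) h2]
  exact hT.subset n _ _ (by linarith) (by linarith) (by linarith)

theorem chainSet_natCast_mono (hT : PolydiscChain T) : Monotone fun n : ℕ => chainSet T n := by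
  refine monotone_nat_of_le_succ fun n => subset_closure.trans ?_
  exact hT.closure_subset_of_le (n := n) le_rfl (by push_cast; linarith) (by push_cast; rfl)

theorem closure_subset (hT : PolydiscChain T) {t s : ℝ} (ht : 0 ≤ t) (hts : t < s) :
    closure (chainSet T t) ⊆ chainSet T s := by
  have hn := Nat.floor_le ht
  have hs := Nat.floor_le (ht.trans hts.le)
  have hs' := Nat.lt_floor_add_one s
  rcases le_or_gt s (⌊t⌋₊ + 1) with h | h
  · exact hT.closure_subset_of_le hn hts h
  · have h1 : closure (chainSet T t) ⊆ chainSet T ((⌊t⌋₊ + 1 : ℕ) : ℝ) :=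
      hT.closure_subset_of_le hn (by push_cast; exact Nat.lt_floor_add_one t) (by push_cast; rfl)
    have h2 : ⌊t⌋₊ + 1 ≤ ⌊s⌋₊ := Nat.le_floor (by push_cast; exact h.le)
    refine h1.trans ((hT.chainSet_natCast_mono h2).trans ?_)
    rcases hs.eq_or_lt with h3 | h3
    · simp only [h3]; rfl
    · exact subset_closure.trans (hT.closure_subset_of_le le_rfl h3 hs'.le)

theorem relCompactIn (hT : PolydiscChain T) {t s : ℝ} (ht : 0 ≤ t) (hts : t < s) :
    RelCompactIn (chainSet T t) (chainSet T s) := by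
  refine ⟨?_, hT.closure_subset ht hts⟩
  have h1 := Nat.floor_le ht
  have h2 := Nat.lt_floor_add_one t
  rw [hT.closure_chainSet h1 h2.le]
  exact (hT.isAut _ _ ⟨by linarith, by linarith⟩).isCompact_preimage

theorem biholomorphic (hT : PolydiscChain T) {t : ℝ} (ht : 0 ≤ t) :
    Biholomorphic (chainSet T t) (unitPolydisc k) :=
  (hT.isAut _ _ ⟨by linarith [Nat.floor_le ht],
    by linarith [Nat.lt_floor_add_one t]⟩).biholomorphic_preimage (isOpen_unitPolydisc k)

theorem eq_iUnion (hT : PolydiscChain T) {t : ℝ} (ht : 0 < t) :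
    chainSet T t = ⋃ t' ∈ Ico 0 t, chainSet T t' := by
  refine Subset.antisymm (fun v hv => ?_)
    (iUnion₂_subset fun t' h => subset_closure.trans (hT.closure_subset h.1 h.2))
  -- The ceiling, not the floor, gives n < t ≤ n + 1, which leaves room to approach `t` from the
  -- left inside piece `n`.
  obtain ⟨n, hn⟩ : ∃ n : ℕ, ⌈t⌉₊ = n + 1 := Nat.exists_eq_succ_of_ne_zero (Nat.ceil_pos.2 ht).ne'
  have h1 : (n : ℝ) < t := by
    have := Nat.ceil_lt_add_one ht.le
    rw [hn] at this
    push_cast at this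
    linarith
  have h2 : t ≤ n + 1 := by exact_mod_cast hn ▸ Nat.le_ceil t
  rw [hT.chainSet_eq h1.le h2] at hv
  have hc : Tendsto (fun τ => T n τ v) (𝓝[Icc 0 1] (t - n)) (𝓝 (T n (t - n) v)) :=
    hT.continuousOn n v _ ⟨by linarith, by linarith⟩
  have hsub : 𝓝[Ico 0 (t - n)] (t - n) ≤ 𝓝[Icc 0 1] (t - n) :=
    nhdsWithin_mono _ fun x hx => ⟨hx.1, by linarith [hx.2]⟩
  have hev := (hc.mono_left hsub).eventually ((isOpen_unitPolydisc k).mem_nhds hv)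
  have hne : (𝓝[Ico 0 (t - n)] (t - n)).NeBot := by
    rw [nhdsWithin_Ico_eq_nhdsLT (by linarith)]
    infer_instance
  obtain ⟨τ, hτ, hτ'⟩ := (hev.and self_mem_nhdsWithin).exists
  have hn0 : (0 : ℝ) ≤ n := n.cast_nonneg
  refine mem_iUnion₂.2 ⟨τ + n, ⟨by linarith [hτ'.1], by linarith [hτ'.2]⟩, ?_⟩
  rw [hT.chainSet_eq (n := n) (by linarith [hτ'.1]) (by linarith [hτ'.2]), add_sub_cancel_right]
  exact hτ

/-- A point in all later sets has images in the polydisc for parameters decreasing to that of `t`;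
by continuity its limit image lies in the closed polydisc. -/
theorem closure_eq_iInter (hT : PolydiscChain T) {t : ℝ} (ht : 0 ≤ t) :
    closure (chainSet T t) = ⋂ s ∈ Ioi t, chainSet T s := by
  refine Subset.antisymm (subset_iInter₂ fun s h => hT.closure_subset ht h) fun v hv => ?_
  have h1 := Nat.floor_le ht
  have h2 := Nat.lt_floor_add_one t
  set n := ⌊t⌋₊
  rw [hT.closure_chainSet h1 h2.le]
  have hc : Tendsto (fun τ => T n τ v) (𝓝[Icc 0 1] (t - n)) (𝓝 (T n (t - n) v)) :=
    hT.continuousOn n v _ ⟨by linarith, by linarith⟩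
  have hsub : 𝓝[Ioc (t - n) 1] (t - n) ≤ 𝓝[Icc 0 1] (t - n) :=
    nhdsWithin_mono _ fun x hx => ⟨by linarith [hx.1], hx.2⟩
  have hne : (𝓝[Ioc (t - n) 1] (t - n)).NeBot := by
    rw [nhdsWithin_Ioc_eq_nhdsGT (by linarith)]
    infer_instance
  refine (isCompact_closedUnitPolydisc k).isClosed.mem_of_tendsto (hc.mono_left hsub) ?_
  filter_upwards [self_mem_nhdsWithin] with τ hτ
  have h3 := mem_iInter₂.1 hv (τ + n) (show t < τ + n by linarith [hτ.1])
  rw [hT.chainSet_eq (n := n) (by linarith [hτ.1]) (by linarith [hτ.2]),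
    add_sub_cancel_right] at h3
  exact fun i => (h3 i).le

theorem isLoewnerShort (hT : PolydiscChain T) {Ω : Set (Cn k)} (hΩ : IsShort Ω)
    (hU : Ω = ⋃ t ∈ Ici (0 : ℝ), chainSet T t) : IsLoewnerShort Ω :=
  ⟨hΩ, chainSet T, hU, Or.inr fun _ ht => hT.biholomorphic ht,
    fun _ _ ht hts => hT.relCompactIn ht hts, fun _ ht => hT.eq_iUnion ht,
    fun _ ht => hT.closure_eq_iInter ht⟩

end PolydiscChain

/-! ### Orbits of the non-autonomous system -/

/-- The orbit `F n ∘ ⋯ ∘ F 1` of the sequence of Hénon maps. -/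
def orbit (d : ℕ) (q : ℕ → Polynomial ℂ) (δ : ℕ → ℂ) (n : ℕ) : Cn 2 → Cn 2 :=
  compUpTo (fun n => henonMap d (q n) (δ n)) n

/-- The standing assumptions, with `η n` the bound for the coefficients of the `n`-th map. -/
structure HenonSeq (d : ℕ) (q : ℕ → Polynomial ℂ) (δ : ℕ → ℂ) (η : ℕ → ℝ) : Prop where
  two_le : 2 ≤ d
  natDegree_lt : ∀ n, 1 ≤ n → (q n).natDegree < d
  coeff_le : ∀ n, 1 ≤ n → ∀ i, ‖(q n).coeff i‖ ≤ η n
  ne_zero : ∀ n, 1 ≤ n → δ n ≠ 0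
  norm_le : ∀ n, 1 ≤ n → ‖δ n‖ ≤ η n
  eta_pos : ∀ n, 1 ≤ n → 0 < η n
  eta_lt_one : ∀ n, 1 ≤ n → η n < 1
  eta_succ : ∀ n, 1 ≤ n → η (n + 1) ≤ η n ^ d

variable {d : ℕ} {q : ℕ → Polynomial ℂ} {δ : ℕ → ℂ} {η : ℕ → ℝ}

theorem orbit_succ_zero (n : ℕ) (v : Cn 2) : orbit d q δ (n + 1) v 0 =
    orbit d q δ n v 0 ^ d + (q (n + 1)).eval (orbit d q δ n v 0) +
      δ (n + 1) * orbit d q δ n v 1 := rfl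

theorem orbit_succ_one (n : ℕ) (v : Cn 2) :
    orbit d q δ (n + 1) v 1 = δ (n + 1) * orbit d q δ n v 0 := rfl

namespace HenonSeq

theorem isAut_orbit (H : HenonSeq d q δ η) (n : ℕ) : IsAut (orbit d q δ n) :=
  isAut_compUpTo (fun n hn => isAut_henonMap d (q n) (H.ne_zero n hn)) n

theorem eta_add_le (H : HenonSeq d q δ η) {n : ℕ} (hn : 1 ≤ n) (k : ℕ) :
    η (n + k) ≤ η n ^ d ^ k := by
  induction k with
  | zero => simp
  | succ k ih =>
    calc η (n + k + 1) ≤ η (n + k) ^ d := H.eta_succ _ (hn.trans (Nat.le_add_right _ _))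
      _ ≤ (η n ^ d ^ k) ^ d :=
        pow_le_pow_left₀ (H.eta_pos _ (hn.trans (Nat.le_add_right _ _))).le ih d
      _ = η n ^ d ^ (k + 1) := by rw [← pow_mul, pow_succ]

theorem exists_eta_le (H : HenonSeq d q δ η) {ε : ℝ} (hε : 0 < ε) : ∃ N, 1 ≤ N ∧ η N ≤ ε := by
  obtain ⟨k, hk⟩ := exists_pow_lt_of_lt_one hε (H.eta_lt_one 1 le_rfl)
  refine ⟨1 + k, Nat.le_add_right _ _, (H.eta_add_le le_rfl k).trans (le_trans ?_ hk.le)⟩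
  exact pow_le_pow_of_le_one (H.eta_pos 1 le_rfl).le (H.eta_lt_one 1 le_rfl).le
    (Nat.lt_pow_self H.two_le).le

theorem norm_eval_le_sum (H : HenonSeq d q δ η) {n : ℕ} (hn : 1 ≤ n) (z : ℂ) :
    ‖(q n).eval z‖ ≤ ∑ i ∈ Finset.range d, η n * ‖z‖ ^ i := by
  rw [Polynomial.eval_eq_sum_range' (H.natDegree_lt n hn)]
  refine (norm_sum_le _ _).trans (Finset.sum_le_sum fun i _ => ?_)
  rw [norm_mul, norm_pow]
  exact mul_le_mul_of_nonneg_right (H.coeff_le n hn i) (by positivity)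

theorem norm_eval_le (H : HenonSeq d q δ η) {n : ℕ} (hn : 1 ≤ n) {z : ℂ} (hz : ‖z‖ ≤ 1) :
    ‖(q n).eval z‖ ≤ d * η n := by
  refine (H.norm_eval_le_sum hn z).trans ?_
  calc ∑ i ∈ Finset.range d, η n * ‖z‖ ^ i ≤ ∑ i ∈ Finset.range d, η n :=
        Finset.sum_le_sum fun i _ => mul_le_of_le_one_right (H.eta_pos n hn).le
          (pow_le_one₀ (norm_nonneg _) hz)
    _ = d * η n := by simp

theorem add_mul_eta_le (H : HenonSeq d q δ η) {N : ℕ} (hN : 1 ≤ N)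
    (hs : 64 * (d + 1) * η N ≤ 1) (k : ℕ) :
    (d + 1) * η (N + k) ≤ (1 / 8) ^ d ^ k / 8 := by
  have hd : (0 : ℝ) < d + 1 := by positivity
  have hdk : d ^ k ≠ 0 := pow_ne_zero _ (by have := H.two_le; omega)
  -- In the power d^k, the first factor supplies the decay and the second absorbs d + 1.
  have h1 : η N ≤ 1 / 8 * (1 / (8 * (d + 1))) := by
    rw [div_mul_div_comm, le_div_iff₀ (by positivity)]
    linarith
  have h2 : (1 / (8 * ((d : ℝ) + 1))) ^ d ^ k ≤ 1 / (8 * (d + 1)) := by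
    refine pow_le_of_le_one (by positivity) ?_ hdk
    rw [div_le_one (by positivity)]
    linarith
  have h3 : η (N + k) ≤ (1 / 8) ^ d ^ k * (1 / (8 * (d + 1))) := by
    refine (H.eta_add_le hN k).trans
      ((pow_le_pow_left₀ (H.eta_pos N hN).le h1 _).trans ?_)
    rw [mul_pow]
    gcongr
  calc (d + 1) * η (N + k) ≤ (d + 1) * ((1 / 8) ^ d ^ k * (1 / (8 * (d + 1)))) := by gcongr
    _ = (1 / 8) ^ d ^ k / 8 := by field_simp

theorem add_mul_eta_le_pow (H : HenonSeq d q δ η) {N : ℕ} (hN : 1 ≤ N)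
    (hs : 64 * (d + 1) * η N ≤ 1) (k : ℕ) :
    (d + 1) * η (N + k) ≤ (1 / 8) ^ k / 64 := by
  refine (H.add_mul_eta_le hN hs k).trans ?_
  have h1 : ((1 : ℝ) / 8) ^ d ^ k ≤ (1 / 8) ^ (k + 1) :=
    pow_le_pow_of_le_one (by norm_num) (by norm_num) (Nat.lt_pow_self H.two_le)
  rw [pow_succ] at h1
  linarith

theorem small_add (H : HenonSeq d q δ η) {N : ℕ} (hN : 1 ≤ N)
    (hs : 64 * (d + 1) * η N ≤ 1) (k : ℕ) : 64 * (d + 1) * η (N + k) ≤ 1 := by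
  have h1 := H.add_mul_eta_le_pow hN hs k
  have h2 : ((1 : ℝ) / 8) ^ k ≤ 1 := pow_le_one₀ (by norm_num) (by norm_num)
  linarith

theorem norm_pow_add_eval_le (H : HenonSeq d q δ η) {n : ℕ} (hn : 1 ≤ n) {z : ℂ} {b : ℝ}
    (hz : ‖z‖ ≤ b) (hb : b ≤ 1 / 2) : ‖z ^ d + (q n).eval z‖ ≤ b / 2 + d * η n := by
  have h0 := norm_nonneg z
  refine (norm_add_le _ _).trans (add_le_add ?_ (H.norm_eval_le hn (by linarith)))
  rw [norm_pow]
  calc ‖z‖ ^ d ≤ ‖z‖ ^ 2 := pow_le_pow_of_le_one h0 (by linarith) H.two_le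
    _ ≤ b / 2 := by nlinarith

theorem norm_orbit_succ_zero_le (H : HenonSeq d q δ η) {n : ℕ} {v : Cn 2} {b : ℝ}
    (h0 : ‖orbit d q δ n v 0‖ ≤ b) (h1 : ‖orbit d q δ n v 1‖ ≤ b) (hb : b ≤ 1 / 2) :
    ‖orbit d q δ (n + 1) v 0‖ ≤ b / 2 + (d + 1) * η (n + 1) := by
  have hn : 1 ≤ n + 1 := Nat.le_add_left 1 n
  have h2 := H.norm_pow_add_eval_le hn h0 hb
  have h3 : ‖δ (n + 1) * orbit d q δ n v 1‖ ≤ η (n + 1) * 1 := by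
    rw [norm_mul]
    exact mul_le_mul (H.norm_le _ hn) (by linarith) (norm_nonneg _) (H.eta_pos _ hn).le
  rw [orbit_succ_zero]
  refine (norm_add_le _ _).trans ?_
  linarith

theorem norm_orbit_succ_one_le (H : HenonSeq d q δ η) {n : ℕ} {v : Cn 2}
    (h0 : ‖orbit d q δ n v 0‖ ≤ 1 / 2) :
    ‖orbit d q δ (n + 1) v 1‖ ≤ (d + 1) * η (n + 1) := by
  have hn : 1 ≤ n + 1 := Nat.le_add_left 1 n
  have hη := H.eta_pos _ hn
  have hd : (0 : ℝ) ≤ d * η (n + 1) := by positivity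
  have h3 : ‖δ (n + 1) * orbit d q δ n v 0‖ ≤ η (n + 1) * 1 := by
    rw [norm_mul]
    exact mul_le_mul (H.norm_le _ hn) (by linarith) (norm_nonneg _) hη.le
  rw [orbit_succ_one]
  linarith

/-- Orbits that enter the closed bidisc of radius `1 / 2` at a late time converge to the origin,
at a uniform rate. -/
theorem norm_orbit_add_le (H : HenonSeq d q δ η) {N : ℕ} (hN : 1 ≤ N)
    (hs : 64 * (d + 1) * η N ≤ 1) {v : Cn 2} (h0 : ‖orbit d q δ N v 0‖ ≤ 1 / 2)
    (h1 : ‖orbit d q δ N v 1‖ ≤ 1 / 2) (k : ℕ) :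
    ‖orbit d q δ (N + k) v 0‖ ≤ (3 / 4) ^ k / 2 ∧
      ‖orbit d q δ (N + k) v 1‖ ≤ (3 / 4) ^ k / 2 := by
  induction k with
  | zero => rw [pow_zero]; exact ⟨h0, h1⟩
  | succ k ih =>
    have hb : ((3 : ℝ) / 4) ^ k ≤ 1 := pow_le_one₀ (by norm_num) (by norm_num)
    have hb0 : (0 : ℝ) < (3 / 4) ^ k := by positivity
    have he := H.add_mul_eta_le_pow hN hs (k + 1)
    have he' : ((1 : ℝ) / 8) ^ (k + 1) ≤ (3 / 4) ^ k := by
      calc ((1 : ℝ) / 8) ^ (k + 1) ≤ (1 / 8) ^ k :=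
            pow_le_pow_of_le_one (by norm_num) (by norm_num) (Nat.le_succ k)
        _ ≤ (3 / 4) ^ k := pow_le_pow_left₀ (by norm_num) (by norm_num) k
    have h2 := H.norm_orbit_succ_zero_le ih.1 ih.2 (by linarith)
    have h3 := H.norm_orbit_succ_one_le (n := N + k) (v := v) (by linarith [ih.1])
    rw [← add_assoc] at he ⊢
    rw [pow_succ (3 / 4 : ℝ) k]
    constructor <;> linarith

theorem norm_orbit_add_le_pow (H : HenonSeq d q δ η) {N : ℕ} (hN : 1 ≤ N)
    (hs : 64 * (d + 1) * η N ≤ 1) {v : Cn 2} (h0 : ‖orbit d q δ N v 0‖ ≤ 1 / 2)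
    (h1 : ‖orbit d q δ N v 1‖ ≤ 1 / 2) (k : ℕ) : ‖orbit d q δ (N + k) v‖ ≤ (3 / 4) ^ k := by
  have h := H.norm_orbit_add_le hN hs h0 h1 k
  exact (norm_le_add_coord _).trans (by linarith [h.1, h.2])

theorem mem_basin_of_norm_le (H : HenonSeq d q δ η) {N : ℕ} (hN : 1 ≤ N)
    (hs : 64 * (d + 1) * η N ≤ 1) {v : Cn 2} (h0 : ‖orbit d q δ N v 0‖ ≤ 1 / 2)
    (h1 : ‖orbit d q δ N v 1‖ ≤ 1 / 2) :
    v ∈ basin fun n => henonMap d (q n) (δ n) := by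
  have h := squeeze_zero_norm (H.norm_orbit_add_le_pow hN hs h0 h1)
    (tendsto_pow_atTop_nhds_zero_of_lt_one (by norm_num) (by norm_num))
  simp_rw [add_comm N] at h
  exact (tendsto_add_atTop_iff_nat N).1 h

theorem tendsto_norm_coord {v : Cn 2} (hv : v ∈ basin fun n => henonMap d (q n) (δ n))
    (i : Fin 2) : Tendsto (fun n => ‖orbit d q δ n v i‖) atTop (𝓝 0) := by
  have h := (differentiable_coord i).continuous.norm.tendsto (0 : Cn 2)
  rw [PiLp.zero_apply, norm_zero] at h
  exact h.comp hv

/-! ### The basin is an increasing union of balls with vanishing Kobayashi metric -/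

theorem preimage_ball_subset (H : HenonSeq d q δ η) {n : ℕ} (hn : 1 ≤ n)
    (hs : 64 * (d + 1) * η n ≤ 1) : orbit d q δ n ⁻¹' Metric.ball 0 (1 / 2) ⊆
      orbit d q δ (n + 1) ⁻¹' Metric.ball 0 (1 / 2) := by
  intro v hv
  rw [mem_preimage, mem_ball_zero_iff] at hv ⊢
  have h0 := (PiLp.norm_apply_le (orbit d q δ n v) 0).trans hv.le
  have h1 := (PiLp.norm_apply_le (orbit d q δ n v) 1).trans hv.le
  have hs' := H.small_add hn hs 1
  have h2 := H.norm_orbit_succ_zero_le h0 h1 le_rfl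
  have h3 := H.norm_orbit_succ_one_le h0
  refine (norm_le_add_coord _).trans_lt ?_
  linarith

theorem basin_eq_iUnion (H : HenonSeq d q δ η) {N : ℕ} (hN : 1 ≤ N)
    (hs : 64 * (d + 1) * η N ≤ 1) : (basin fun n => henonMap d (q n) (δ n)) =
      ⋃ k, orbit d q δ (N + k) ⁻¹' Metric.ball 0 (1 / 2) := by
  ext v
  rw [mem_iUnion]
  constructor
  · intro hv
    have h : ∀ᶠ n in atTop, orbit d q δ n v ∈ Metric.ball (0 : Cn 2) (1 / 2) :=
      hv (Metric.ball_mem_nhds 0 (by norm_num))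
    obtain ⟨n, hn, hn'⟩ := (h.and (eventually_ge_atTop N)).exists
    exact ⟨n - N, by rwa [Nat.add_sub_cancel' hn']⟩
  · rintro ⟨k, hk⟩
    rw [mem_preimage, mem_ball_zero_iff] at hk
    exact H.mem_basin_of_norm_le (hN.trans (Nat.le_add_right _ _)) (H.small_add hN hs k)
      ((PiLp.norm_apply_le _ 0).trans hk.le) ((PiLp.norm_apply_le _ 1).trans hk.le)

theorem biholomorphic_preimage_ball (H : HenonSeq d q δ η) (n : ℕ) :
    Biholomorphic (orbit d q δ n ⁻¹' Metric.ball 0 (1 / 2)) (unitBall 2) := by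
  have hA : IsAut fun v : Cn 2 => (2 : ℂ) • v :=
    ⟨by fun_prop, fun v => (2 : ℂ)⁻¹ • v, by fun_prop,
      fun v => by simp, fun v => by simp⟩
  convert (hA.comp (H.isAut_orbit n)).biholomorphic_preimage (V := unitBall 2)
    Metric.isOpen_ball using 1
  ext v
  simp only [unitBall, mem_preimage, mem_ball_zero_iff, Function.comp_apply, norm_smul,
    Complex.norm_ofNat]
  constructor <;> intro h <;> linarith

theorem exists_basin_eq_iUnion_balls (H : HenonSeq d q δ η) : ∃ B : ℕ → Set (Cn 2),
    (∀ i, Biholomorphic (B i) (unitBall 2)) ∧ (∀ i, B i ⊆ B (i + 1)) ∧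
      (basin fun n => henonMap d (q n) (δ n)) = ⋃ i, B i := by
  obtain ⟨N, hN, hs⟩ := H.exists_eta_le (ε := 1 / (64 * (d + 1))) (by positivity)
  rw [le_div_iff₀' (by positivity)] at hs
  exact ⟨fun k => orbit d q δ (N + k) ⁻¹' Metric.ball 0 (1 / 2),
    fun k => H.biholomorphic_preimage_ball _,
    fun k => H.preimage_ball_subset (hN.trans (Nat.le_add_right _ _)) (H.small_add hN hs k),
    H.basin_eq_iUnion hN hs⟩

theorem kobayashiMetric_eq_zero (H : HenonSeq d q δ η) {p : Cn 2}
    (hp : p ∈ basin fun n => henonMap d (q n) (δ n)) (ξ : Cn 2) :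
    kobayashiMetric (basin fun n => henonMap d (q n) (δ n)) p ξ = 0 := by
  obtain ⟨N, hN, hs⟩ := H.exists_eta_le (ε := 1 / (64 * (d + 1))) (by positivity)
  rw [le_div_iff₀' (by positivity)] at hs
  have hU := H.basin_eq_iUnion hN hs
  have hline : Differentiable ℂ fun ζ : ℂ => p + ζ • ξ := by fun_prop
  obtain ⟨k, hk⟩ := mem_iUnion.1 (hU ▸ hp)
  set n := N + k with hndef
  have hn : 1 ≤ n := hN.trans (Nat.le_add_right _ _)
  have hsn : 64 * (d + 1) * η n ≤ 1 := H.small_add hN hs k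
  have hopen : IsOpen ((fun ζ : ℂ => p + ζ • ξ) ⁻¹'
      (orbit d q δ n ⁻¹' Metric.ball 0 (1 / 2))) :=
    (Metric.isOpen_ball.preimage (H.isAut_orbit n).1.continuous).preimage hline.continuous
  obtain ⟨ρ, hρ, hsub⟩ := Metric.nhds_basis_closedBall.mem_iff.1
    (hopen.mem_nhds (show (0 : ℂ) ∈ _ by simpa using hk))
  have hbound : ∀ ζ ∈ Metric.closedBall (0 : ℂ) ρ, ∀ j,
      ‖orbit d q δ (n + j) (p + ζ • ξ)‖ ≤ (3 / 4) ^ j := by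
    intro ζ hζ j
    have h := mem_ball_zero_iff.1 (hsub hζ)
    exact H.norm_orbit_add_le_pow hn hsn ((PiLp.norm_apply_le _ 0).trans h.le)
      ((PiLp.norm_apply_le _ 1).trans h.le) j
  have hmain : ∀ α : ℝ, 0 < α → ∃ f : ℂ → Cn 2, DifferentiableOn ℂ f (Metric.ball 0 1) ∧
      MapsTo f (Metric.ball 0 1) (basin fun n => henonMap d (q n) (δ n)) ∧ f 0 = p ∧
        (α : ℂ) • deriv f 0 = ξ := by
    intro α hα
    have hα' : (α : ℂ) ≠ 0 := by exact_mod_cast hα.ne'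
    -- The two bounds in the minimum keep the centre `G p` and the radius `‖α⁻¹ ν‖` within 1/4, so
    -- the affine disc below lies in the ball of radius 1/2.
    obtain ⟨j, hj⟩ := exists_pow_lt_of_lt_one (y := (3 / 4 : ℝ))
      (show 0 < min (1 / 4) (α * ρ / 4) by positivity) (by norm_num)
    obtain ⟨dG, g, dg, hl, hr⟩ := H.isAut_orbit (n + j)
    set G := orbit d q δ (n + j) with hG
    set ν := deriv (fun ζ : ℂ => G (p + ζ • ξ)) 0 with hν
    have hGl : Differentiable ℂ fun ζ : ℂ => G (p + ζ • ξ) := dG.comp hline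
    -- Cauchy's estimate on the circle of radius `ρ`, which does not depend on `j`.
    have hν_le : ‖ν‖ ≤ (3 / 4) ^ j / ρ :=
      Complex.norm_deriv_le_of_forall_mem_sphere_norm_le hρ hGl.diffContOnCl
        fun ζ hζ => hbound ζ (Metric.sphere_subset_closedBall hζ) j
    have hη_le : ‖(α : ℂ)⁻¹ • ν‖ ≤ 1 / 4 := by
      rw [norm_smul, norm_inv, Complex.norm_real, Real.norm_of_nonneg hα.le,
        inv_mul_le_iff₀ hα]
      refine hν_le.trans ?_
      rw [div_le_iff₀ hρ]
      linarith [hj.le.trans (min_le_right _ _)]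
    have hGp : ‖G p‖ < 1 / 4 := by
      have h := hbound 0 (by simpa using hρ.le) j
      rw [zero_smul, add_zero] at h
      exact h.trans_lt (hj.trans_le (min_le_left _ _))
    refine ⟨fun ζ => g (G p + ζ • (α : ℂ)⁻¹ • ν), ?_, ?_, ?_, ?_⟩
    · exact (dg.comp (by fun_prop)).differentiableOn
    · intro ζ hζ
      rw [hU]
      refine mem_iUnion.2 ⟨k + j, ?_⟩
      rw [← add_assoc, ← hndef, mem_preimage, ← hG, hr, mem_ball_zero_iff]
      refine (norm_add_le _ _).trans_lt ?_
      rw [norm_smul]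
      have h1 : ‖ζ‖ * ‖(α : ℂ)⁻¹ • ν‖ ≤ 1 * (1 / 4) :=
        mul_le_mul (mem_ball_zero_iff.1 hζ).le hη_le (norm_nonneg _) zero_le_one
      linarith
    · simp only [zero_smul, add_zero]
      exact hl p
    · have h1 : HasDerivAt (fun ζ : ℂ => G p + ζ • (α : ℂ)⁻¹ • ν) ((α : ℂ)⁻¹ • ν) 0 := by
        simpa using ((hasDerivAt_id (0 : ℂ)).smul_const ((α : ℂ)⁻¹ • ν)).const_add (G p)
      have h2 : HasDerivAt (fun ζ : ℂ => g (G p + ζ • (α : ℂ)⁻¹ • ν))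
          (fderiv ℂ g (G p) ((α : ℂ)⁻¹ • ν)) 0 := by
        refine HasFDerivAt.comp_hasDerivAt (0 : ℂ) ?_ h1
        simpa using (dg (G p)).hasFDerivAt
      have h3 : HasDerivAt (fun ζ : ℂ => g (G (p + ζ • ξ))) (fderiv ℂ g (G p) ν) 0 := by
        refine HasFDerivAt.comp_hasDerivAt (f := fun ζ : ℂ => G (p + ζ • ξ)) (0 : ℂ) ?_
          (hGl 0).hasDerivAt
        simpa using (dg (G p)).hasFDerivAt
      -- Since `g` inverts `G`, comparing with `h3` shows that the derivative of `g` at `G p` sends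
      -- `ν` back to `ξ`.
      have h4 : HasDerivAt (fun ζ : ℂ => g (G (p + ζ • ξ))) ξ 0 := by
        have h5 : (fun ζ : ℂ => g (G (p + ζ • ξ))) = fun ζ => p + ζ • ξ := funext fun ζ => hl _
        rw [h5]
        simpa using ((hasDerivAt_id (0 : ℂ)).smul_const ξ).const_add p
      rw [h2.deriv, map_smul, h3.unique h4, smul_inv_smul₀ hα']
  refine le_antisymm (ENNReal.le_of_forall_pos_le_add fun ε hε _ => ?_) zero_le
  rw [zero_add]
  refine (iInf₂_le (ε : ℝ) ⟨NNReal.coe_pos.2 hε, hmain ε (NNReal.coe_pos.2 hε)⟩).trans ?_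
  rw [ENNReal.ofReal_coe_nnreal]

end HenonSeq

/-! ### A bounded plurisubharmonic function on the basin -/

/-- The size of the `n`-th point of the orbit of `v`, bounded below by `η n`. -/
noncomputable def orbitSize (d : ℕ) (q : ℕ → Polynomial ℂ) (δ : ℕ → ℂ) (η : ℕ → ℝ) (n : ℕ) (v : Cn 2) : ℝ :=
  max (max ‖orbit d q δ n v 0‖ ‖orbit d q δ n v 1‖) (η n)

/-- The functions decreasing to the Green function of the basin. -/
noncomputable def greenApprox (d : ℕ) (q : ℕ → Polynomial ℂ) (δ : ℕ → ℂ) (η : ℕ → ℝ) (n : ℕ) (v : Cn 2) : ℝ :=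
  ((d : ℝ) ^ n)⁻¹ * (Real.log (d + 2) + Real.log (orbitSize d q δ η n v))

namespace HenonSeq

theorem orbitSize_pos (H : HenonSeq d q δ η) {n : ℕ} (hn : 1 ≤ n) (v : Cn 2) :
    0 < orbitSize d q δ η n v := lt_max_of_lt_right (H.eta_pos n hn)

/-- Including `η n` in the orbit size is essential when the size is at most 1: then η_{n+1} ≤ η_n^d
is already below its d-th power. -/
theorem eta_succ_mul_pow_le (H : HenonSeq d q δ η) {n : ℕ} (hn : 1 ≤ n) (v : Cn 2) {i : ℕ}
    (hi : i ≤ d) : η (n + 1) * orbitSize d q δ η n v ^ i ≤ orbitSize d q δ η n v ^ d := by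
  have hpos := H.orbitSize_pos hn v
  have hη := H.eta_pos _ (hn.trans n.le_succ)
  rcases le_total (orbitSize d q δ η n v) 1 with h | h
  · calc η (n + 1) * orbitSize d q δ η n v ^ i ≤ η (n + 1) :=
          mul_le_of_le_one_right hη.le (pow_le_one₀ hpos.le h)
      _ ≤ η n ^ d := H.eta_succ n hn
      _ ≤ orbitSize d q δ η n v ^ d := pow_le_pow_left₀ (H.eta_pos n hn).le (le_max_right _ _) d
  · calc η (n + 1) * orbitSize d q δ η n v ^ i ≤ orbitSize d q δ η n v ^ i :=
          mul_le_of_le_one_left (by positivity) (H.eta_lt_one _ (hn.trans n.le_succ)).le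
      _ ≤ orbitSize d q δ η n v ^ d := pow_le_pow_right₀ h hi

/-- The constant counts terms: one for z^d, d for the coefficients of q, one for δw. -/
theorem orbitSize_succ_le (H : HenonSeq d q δ η) {n : ℕ} (hn : 1 ≤ n) (v : Cn 2) :
    orbitSize d q δ η (n + 1) v ≤ (d + 2) * orbitSize d q δ η n v ^ d := by
  have hpos := H.orbitSize_pos hn v
  have hn' : 1 ≤ n + 1 := hn.trans n.le_succ
  have hη := H.eta_pos _ hn'
  have hd := H.two_le
  have hz : ‖orbit d q δ n v 0‖ ≤ orbitSize d q δ η n v :=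
    (le_max_left _ _).trans (le_max_left _ _)
  have hw : ‖orbit d q δ n v 1‖ ≤ orbitSize d q δ η n v :=
    (le_max_right _ _).trans (le_max_left _ _)
  have hpow : 0 < orbitSize d q δ η n v ^ d := by positivity
  have hdpow : 0 ≤ d * orbitSize d q δ η n v ^ d := by positivity
  have hlin : ∀ x : ℂ, ‖x‖ ≤ orbitSize d q δ η n v →
      ‖δ (n + 1) * x‖ ≤ orbitSize d q δ η n v ^ d := fun x hx => by
    rw [norm_mul]
    refine (mul_le_mul (H.norm_le _ hn') hx (norm_nonneg _) hη.le).trans ?_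
    simpa using H.eta_succ_mul_pow_le hn v (i := 1) (by omega)
  refine max_le (max_le ?_ ?_) ?_
  · rw [orbit_succ_zero]
    have h1 : ‖orbit d q δ n v 0 ^ d‖ ≤ orbitSize d q δ η n v ^ d := by
      rw [norm_pow]
      exact pow_le_pow_left₀ (norm_nonneg _) hz d
    have h2 : ‖(q (n + 1)).eval (orbit d q δ n v 0)‖ ≤ d * orbitSize d q δ η n v ^ d := by
      refine (H.norm_eval_le_sum hn' _).trans ?_
      have h := Finset.sum_le_card_nsmul (Finset.range d)
        (fun i => η (n + 1) * ‖orbit d q δ n v 0‖ ^ i) (orbitSize d q δ η n v ^ d) fun i hi => by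
          refine le_trans ?_ (H.eta_succ_mul_pow_le hn v (Finset.mem_range.1 hi).le)
          gcongr
      rwa [Finset.card_range, nsmul_eq_mul] at h
    refine (norm_add₃_le).trans ?_
    linarith [hlin _ hw]
  · rw [orbit_succ_one]
    linarith [hlin _ hz]
  · have h := H.eta_succ_mul_pow_le hn v (i := 0) (Nat.zero_le _)
    rw [pow_zero, mul_one] at h
    linarith

/-- After taking logarithms of `orbitSize_succ_le`, the additive constant is 2 log (d+2), at most d
log (d+2). -/
theorem greenApprox_succ_le (H : HenonSeq d q δ η) {n : ℕ} (hn : 1 ≤ n) (v : Cn 2) :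
    greenApprox d q δ η (n + 1) v ≤ greenApprox d q δ η n v := by
  have hpos := H.orbitSize_pos hn v
  have hd : (2 : ℝ) ≤ d := by exact_mod_cast H.two_le
  have h1 : Real.log (orbitSize d q δ η (n + 1) v) ≤
      Real.log (d + 2) + d * Real.log (orbitSize d q δ η n v) := by
    rw [← Real.log_pow, ← Real.log_mul (by positivity) (by positivity)]
    exact Real.log_le_log (H.orbitSize_pos (hn.trans n.le_succ) v) (H.orbitSize_succ_le hn v)
  have h2 : 0 ≤ Real.log (d + 2) := Real.log_nonneg (by linarith)
  have h3 : 2 * Real.log (d + 2) ≤ d * Real.log (d + 2) := mul_le_mul_of_nonneg_right hd h2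
  have h4 : ((d : ℝ) ^ n)⁻¹ = ((d : ℝ) ^ (n + 1))⁻¹ * d := by
    rw [pow_succ]
    field_simp
  rw [greenApprox, greenApprox, h4, mul_assoc]
  gcongr
  linarith

theorem antitone_greenApprox (H : HenonSeq d q δ η) {N : ℕ} (hN : 1 ≤ N) (v : Cn 2) :
    Antitone fun k => greenApprox d q δ η (N + k) v :=
  antitone_nat_of_succ_le fun k => H.greenApprox_succ_le (hN.trans (Nat.le_add_right N k)) v

theorem hasSubMean_greenApprox (H : HenonSeq d q δ η) {n : ℕ} (hn : 1 ≤ n) :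
    HasSubMean (greenApprox d q δ η n) :=
  (hasSubMean_log_max ((differentiable_coord 0).comp (H.isAut_orbit n).1)
    ((differentiable_coord 1).comp (H.isAut_orbit n).1) (H.eta_pos n hn)).const_mul_const_add
    (by positivity) _

theorem tendsto_eta (H : HenonSeq d q δ η) : Tendsto η atTop (𝓝 0) := by
  refine (tendsto_add_atTop_iff_nat 1).1 (squeeze_zero
    (fun n => (H.eta_pos _ (Nat.le_add_left 1 n)).le) (fun n => ?_)
    (tendsto_pow_atTop_nhds_zero_of_lt_one (H.eta_pos 1 le_rfl).le (H.eta_lt_one 1 le_rfl)))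
  rw [add_comm]
  exact (H.eta_add_le le_rfl n).trans (pow_le_pow_of_le_one (H.eta_pos 1 le_rfl).le
    (H.eta_lt_one 1 le_rfl).le (Nat.lt_pow_self H.two_le).le)

theorem tendsto_orbitSize (H : HenonSeq d q δ η) {v : Cn 2}
    (hv : v ∈ basin fun n => henonMap d (q n) (δ n)) :
    Tendsto (fun n => orbitSize d q δ η n v) atTop (𝓝 0) := by
  have h := ((tendsto_norm_coord hv 0).max (tendsto_norm_coord hv 1)).max H.tendsto_eta
  rwa [max_self, max_self] at h

/-- On the basin the orbit size eventually drops below 1/(d+2), making a single term nonpositive. -/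
theorem iInf_greenApprox_le_zero (H : HenonSeq d q δ η) {N : ℕ} (hN : 1 ≤ N) {v : Cn 2}
    (hv : v ∈ basin fun n => henonMap d (q n) (δ n)) :
    (⨅ k, (greenApprox d q δ η (N + k) v : EReal)) ≤ ((0 : ℝ) : EReal) := by
  have hd : (0 : ℝ) < d + 2 := by positivity
  obtain ⟨n, hn, hn'⟩ := (((H.tendsto_orbitSize hv).eventually_lt_const
    (show 0 < ((d : ℝ) + 2)⁻¹ by positivity)).and (eventually_ge_atTop N)).exists
  refine (iInf_le _ (n - N)).trans (EReal.coe_le_coe_iff.2 ?_)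
  rw [Nat.add_sub_cancel' hn', greenApprox]
  refine mul_nonpos_of_nonneg_of_nonpos (by positivity) ?_
  have h := Real.log_le_log (H.orbitSize_pos (hN.trans hn') v) hn.le
  rw [Real.log_inv] at h
  linarith

/-- Lower bound for the orbit of a point that is at `(1 / 4, 0)` at a late time. -/
theorem le_norm_orbit (H : HenonSeq d q δ η) {N : ℕ} (hN : 1 ≤ N)
    (hs : 64 * (d + 1) * η N ≤ 1) {v : Cn 2} (hv0 : orbit d q δ N v 0 = 1 / 4)
    (hv1 : orbit d q δ N v 1 = 0) (k : ℕ) :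
    2 * (1 / 8) ^ d ^ k ≤ ‖orbit d q δ (N + k) v 0‖ := by
  induction k with
  | zero =>
    rw [add_zero, hv0]
    norm_num
  | succ k ih =>
    have hb := H.norm_orbit_add_le hN hs (v := v) (by rw [hv0]; norm_num)
      (by rw [hv1]; norm_num) k
    have hk : ((3 : ℝ) / 4) ^ k ≤ 1 := pow_le_one₀ (by norm_num) (by norm_num)
    have hn : 1 ≤ N + (k + 1) := hN.trans (Nat.le_add_right _ _)
    have hη := H.add_mul_eta_le hN hs (k + 1)
    have hηp := H.eta_pos _ hn
    have h1 := H.norm_eval_le hn (z := orbit d q δ (N + k) v 0) (by linarith [hb.1])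
    have h2 : ‖δ (N + (k + 1)) * orbit d q δ (N + k) v 1‖ ≤ η (N + (k + 1)) * 1 := by
      rw [norm_mul]
      exact mul_le_mul (H.norm_le _ hn) (by linarith [hb.2]) (norm_nonneg _) hηp.le
    -- The factor 2 in the induction hypothesis becomes 2^d ≥ 4; the surplus pays for the
    -- perturbation, at most an eighth of (1/8)^(d^(k+1)).
    have h3 : 4 * (1 / 8) ^ d ^ (k + 1) ≤ ‖orbit d q δ (N + k) v 0‖ ^ d := by
      calc (4 : ℝ) * (1 / 8) ^ d ^ (k + 1) = 2 ^ 2 * ((1 / 8) ^ d ^ k) ^ d := by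
            rw [← pow_mul, pow_succ]; norm_num
        _ ≤ 2 ^ d * ((1 / 8) ^ d ^ k) ^ d := by
            gcongr
            · norm_num
            · exact H.two_le
        _ = (2 * (1 / 8) ^ d ^ k) ^ d := by rw [mul_pow]
        _ ≤ _ := pow_le_pow_left₀ (by positivity) ih d
    have h4 : (0 : ℝ) < (1 / 8) ^ d ^ (k + 1) := by positivity
    have h5 := norm_sub_le (orbit d q δ (N + (k + 1)) v 0)
      ((q (N + (k + 1))).eval (orbit d q δ (N + k) v 0) +
        δ (N + (k + 1)) * orbit d q δ (N + k) v 1)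
    have h6 := norm_add_le ((q (N + (k + 1))).eval (orbit d q δ (N + k) v 0))
      (δ (N + (k + 1)) * orbit d q δ (N + k) v 1)
    have h7 : orbit d q δ (N + (k + 1)) v 0 - ((q (N + (k + 1))).eval (orbit d q δ (N + k) v 0) +
        δ (N + (k + 1)) * orbit d q δ (N + k) v 1) = orbit d q δ (N + k) v 0 ^ d := by
      rw [← add_assoc N k 1, orbit_succ_zero]
      ring
    rw [h7, norm_pow] at h5
    linarith

theorem exists_plurisubharmonic (H : HenonSeq d q δ η) : ∃ u : Cn 2 → EReal,
    IsPlurisubharmonicOn u (basin fun n => henonMap d (q n) (δ n)) ∧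
    (∃ C : ℝ, ∀ p ∈ basin fun n => henonMap d (q n) (δ n), u p ≤ (C : EReal)) ∧
    ∃ p ∈ basin fun n => henonMap d (q n) (δ n),
      ∃ p' ∈ basin fun n => henonMap d (q n) (δ n), u p ≠ u p' := by
  -- This smallness makes (d+2) η_N < 1/8. The value at a point sent to 0 at time `N` is then
  -- strictly below d^{-N} log (1/8), a lower bound for the value at a point sent to (1/4, 0).
  obtain ⟨N, hN, hs⟩ := H.exists_eta_le (ε := 1 / (64 * (d + 2))) (by positivity)
  rw [le_div_iff₀' (by positivity)] at hs
  have hηN := H.eta_pos N hN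
  have hs' : 64 * (d + 1) * η N ≤ 1 := by nlinarith
  have hd0 : (0 : ℝ) < d := by exact_mod_cast (zero_lt_two.trans_le H.two_le)
  refine ⟨fun v => ⨅ k, (greenApprox d q δ η (N + k) v : EReal),
    isPlurisubharmonicOn_iInf
      (fun k => H.hasSubMean_greenApprox (hN.trans (Nat.le_add_right N k)))
      (fun v => H.antitone_greenApprox hN v) _,
    ⟨0, fun p hp => H.iInf_greenApprox_le_zero hN hp⟩, ?_⟩
  obtain ⟨p, hp⟩ := (H.isAut_orbit N).surjective 0
  obtain ⟨p', hp'⟩ := (H.isAut_orbit N).surjective !₂[1 / 4, 0]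
  have hp'0 : orbit d q δ N p' 0 = 1 / 4 := by rw [hp']; simp
  have hp'1 : orbit d q δ N p' 1 = 0 := by rw [hp']; simp
  refine ⟨p, H.mem_basin_of_norm_le hN hs' (by rw [hp]; simp) (by rw [hp]; simp),
    p', H.mem_basin_of_norm_le hN hs' (by rw [hp'0]; norm_num) (by rw [hp'1]; norm_num),
    ne_of_lt ?_⟩
  have hlow : (((d : ℝ) ^ N)⁻¹ * Real.log (1 / 8) : ℝ) ≤
      ⨅ k, (greenApprox d q δ η (N + k) p' : EReal) := by
    refine le_iInf fun k => EReal.coe_le_coe_iff.2 ?_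
    have h1 : (1 / 8) ^ d ^ k ≤ orbitSize d q δ η (N + k) p' := by
      refine le_trans ?_ ((H.le_norm_orbit hN hs' hp'0 hp'1 k).trans
        ((le_max_left _ _).trans (le_max_left _ _)))
      have : (0 : ℝ) < (1 / 8) ^ d ^ k := by positivity
      linarith
    have h2 := Real.log_le_log (by positivity) h1
    rw [Real.log_pow] at h2
    have h3 : 0 ≤ Real.log (d + 2) := Real.log_nonneg (by linarith)
    have h4 : ((d : ℝ) ^ N)⁻¹ * Real.log (1 / 8) =
        ((d : ℝ) ^ (N + k))⁻¹ * ((d ^ k : ℕ) * Real.log (1 / 8)) := by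
      rw [pow_add]
      push_cast
      field_simp
    rw [h4, greenApprox]
    gcongr
    linarith
  refine lt_of_le_of_lt (iInf_le _ 0) (lt_of_lt_of_le (EReal.coe_lt_coe_iff.2 ?_) hlow)
  have h1 : orbitSize d q δ η N p = η N := by
    rw [orbitSize, hp]
    simpa using hηN.le
  rw [add_zero, greenApprox, h1, ← Real.log_mul (by positivity) hηN.ne']
  refine mul_lt_mul_of_pos_left (Real.log_lt_log (by positivity) ?_) (by positivity)
  linarith

end HenonSeq

/-! ### The Loewner chain -/

/-- The increasing sequence of radii of the bidiscs that are pulled back to the Loewner chain. -/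
noncomputable def chainRadius (n : ℕ) : ℝ := 1 / 2 - 1 / (n + 10)

theorem chainRadius_lt_succ (n : ℕ) : chainRadius n < chainRadius (n + 1) := by
  have h : (1 : ℝ) / ((n + 1 : ℕ) + 10) < 1 / (n + 10) :=
    one_div_lt_one_div_of_lt (by positivity) (by push_cast; linarith)
  unfold chainRadius
  linarith

theorem le_chainRadius (n : ℕ) : 2 / 5 ≤ chainRadius n := by
  have h : (1 : ℝ) / (n + 10) ≤ 1 / 10 :=
    one_div_le_one_div_of_le (by norm_num) (by linarith [n.cast_nonneg (α := ℝ)])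
  unfold chainRadius
  linarith

theorem chainRadius_lt (n : ℕ) : chainRadius n < 1 / 2 := by
  have h : (0 : ℝ) < 1 / (n + 10) := by positivity
  unfold chainRadius
  linarith

/-- The radius of the first coordinate in the `n`-th chain. -/
noncomputable def chainFst (n : ℕ) (τ : ℝ) : ℝ := (1 - τ) * chainRadius n + τ * chainRadius (n + 1)

/-- The radius of the second coordinate in the `n`-th chain of a system started at time `N`. -/
noncomputable def chainSnd (δ : ℕ → ℂ) (N n : ℕ) (τ : ℝ) : ℝ :=
  (1 - τ) * (‖δ (N + n + 1)‖ * (‖δ (N + n)‖ * chainRadius n)) + τ * chainRadius (n + 1)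

/-- The automorphisms defining the Loewner chain of a system started at time `N`: the `n`-th orbit
map followed by shears that interpolate between the identity and the next Hénon map. -/
noncomputable def chainMap (d : ℕ) (q : ℕ → Polynomial ℂ) (δ : ℕ → ℂ) (N n : ℕ) (τ : ℝ) (v : Cn 2) : Cn 2 :=
  !₂[(chainFst n τ : ℂ)⁻¹ * orbit d q δ (N + n) v 0,
    (δ (N + n + 1) / chainSnd δ N n τ) * orbit d q δ (N + n) v 1 +
      (τ / chainSnd δ N n τ) * (orbit d q δ (N + n) v 0 ^ d +
        (q (N + n + 1)).eval (orbit d q δ (N + n) v 0))]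

theorem chainFst_pos {n : ℕ} {τ : ℝ} (h : τ ∈ Icc (0 : ℝ) 1) : 0 < chainFst n τ := by
  have h1 := le_chainRadius n
  have h2 := chainRadius_lt_succ n
  unfold chainFst
  nlinarith [h.1, h.2]

namespace HenonSeq

theorem chainSnd_pos (H : HenonSeq d q δ η) {N : ℕ} (hN : 1 ≤ N) {n : ℕ} {τ : ℝ}
    (h : τ ∈ Icc (0 : ℝ) 1) : 0 < chainSnd δ N n τ := by
  have h1 := le_chainRadius n
  have h2 := le_chainRadius (n + 1)
  have h3 : 0 < ‖δ (N + n + 1)‖ := norm_pos_iff.2 (H.ne_zero _ (Nat.le_add_left 1 _))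
  have h4 : 0 < ‖δ (N + n)‖ := norm_pos_iff.2 (H.ne_zero _ (hN.trans (Nat.le_add_right _ _)))
  have h5 : 0 < ‖δ (N + n + 1)‖ * (‖δ (N + n)‖ * chainRadius n) := by positivity
  unfold chainSnd
  rcases h.1.eq_or_lt with h0 | h0
  · rw [← h0]
    linarith
  · have h6 := mul_nonneg (sub_nonneg.2 h.2) h5.le
    have h7 : 0 < τ * chainRadius (n + 1) := by positivity
    linarith

theorem isAut_chainMap (H : HenonSeq d q δ η) {N : ℕ} (hN : 1 ≤ N) {n : ℕ} {τ : ℝ}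
    (h : τ ∈ Icc (0 : ℝ) 1) : IsAut (chainMap d q δ N n τ) := by
  have h1 : (chainFst n τ : ℂ) ≠ 0 := by exact_mod_cast (chainFst_pos h).ne'
  have h2 : (chainSnd δ N n τ : ℂ) ≠ 0 := by exact_mod_cast (H.chainSnd_pos hN h).ne'
  have hP : Differentiable ℂ fun z : ℂ =>
      ((τ : ℂ) / chainSnd δ N n τ) * (z ^ d + (q (N + n + 1)).eval z) :=
    (((differentiable_id.pow d).add (q (N + n + 1)).differentiable)).const_mul _
  exact (isAut_shear (inv_ne_zero h1) (div_ne_zero (H.ne_zero _ (Nat.le_add_left 1 _)) h2)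
    hP).comp (H.isAut_orbit (N + n))

theorem norm_chainMap_zero {N n : ℕ} {τ : ℝ} (h : τ ∈ Icc (0 : ℝ) 1)
    (v : Cn 2) : ‖chainMap d q δ N n τ v 0‖ = ‖orbit d q δ (N + n) v 0‖ / chainFst n τ := by
  have h1 : chainMap d q δ N n τ v 0 = (chainFst n τ : ℂ)⁻¹ * orbit d q δ (N + n) v 0 := rfl
  rw [h1, norm_mul, norm_inv, Complex.norm_real, Real.norm_of_nonneg (chainFst_pos h).le,
    inv_mul_eq_div]

theorem norm_chainMap_one (H : HenonSeq d q δ η) {N : ℕ} (hN : 1 ≤ N) {n : ℕ} {τ : ℝ}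
    (h : τ ∈ Icc (0 : ℝ) 1) (v : Cn 2) : ‖chainMap d q δ N n τ v 1‖ =
      ‖δ (N + n + 1) * orbit d q δ (N + n) v 1 + τ * (orbit d q δ (N + n) v 0 ^ d +
        (q (N + n + 1)).eval (orbit d q δ (N + n) v 0))‖ / chainSnd δ N n τ := by
  have h1 : chainMap d q δ N n τ v 1 =
      (δ (N + n + 1) * orbit d q δ (N + n) v 1 + τ * (orbit d q δ (N + n) v 0 ^ d +
        (q (N + n + 1)).eval (orbit d q δ (N + n) v 0))) / chainSnd δ N n τ := by
    rw [add_div, mul_div_right_comm, mul_div_right_comm]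
    rfl
  rw [h1, norm_div, Complex.norm_real, Real.norm_of_nonneg (H.chainSnd_pos hN h).le]

theorem mem_preimage_unitPolydisc_iff (H : HenonSeq d q δ η) {N : ℕ} (hN : 1 ≤ N) {n : ℕ} {τ : ℝ}
    (h : τ ∈ Icc (0 : ℝ) 1) (v : Cn 2) : v ∈ chainMap d q δ N n τ ⁻¹' unitPolydisc 2 ↔
      ‖orbit d q δ (N + n) v 0‖ < chainFst n τ ∧
      ‖δ (N + n + 1) * orbit d q δ (N + n) v 1 + τ * (orbit d q δ (N + n) v 0 ^ d +
        (q (N + n + 1)).eval (orbit d q δ (N + n) v 0))‖ < chainSnd δ N n τ := by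
  rw [mem_preimage, unitPolydisc, mem_ofPred_eq, Fin.forall_fin_two, norm_chainMap_zero h,
    H.norm_chainMap_one hN h, div_lt_one (chainFst_pos h), div_lt_one (H.chainSnd_pos hN h)]

theorem mem_preimage_closedUnitPolydisc_iff (H : HenonSeq d q δ η) {N : ℕ} (hN : 1 ≤ N) {n : ℕ}
    {τ : ℝ} (h : τ ∈ Icc (0 : ℝ) 1) (v : Cn 2) :
    v ∈ chainMap d q δ N n τ ⁻¹' closedUnitPolydisc 2 ↔
      ‖orbit d q δ (N + n) v 0‖ ≤ chainFst n τ ∧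
      ‖δ (N + n + 1) * orbit d q δ (N + n) v 1 + τ * (orbit d q δ (N + n) v 0 ^ d +
        (q (N + n + 1)).eval (orbit d q δ (N + n) v 0))‖ ≤ chainSnd δ N n τ := by
  rw [mem_preimage, closedUnitPolydisc, mem_ofPred_eq, Fin.forall_fin_two, norm_chainMap_zero h,
    H.norm_chainMap_one hN h, div_le_one (chainFst_pos h), div_le_one (H.chainSnd_pos hN h)]

theorem mem_preimage_start_iff (H : HenonSeq d q δ η) {N : ℕ} (hN : 1 ≤ N) {n : ℕ} (v : Cn 2) :
    v ∈ chainMap d q δ N n 0 ⁻¹' unitPolydisc 2 ↔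
      ‖orbit d q δ (N + n) v 0‖ < chainRadius n ∧
      ‖orbit d q δ (N + n) v 1‖ < ‖δ (N + n)‖ * chainRadius n := by
  have h3 : 0 < ‖δ (N + n + 1)‖ := norm_pos_iff.2 (H.ne_zero _ (Nat.le_add_left 1 _))
  rw [H.mem_preimage_unitPolydisc_iff hN ⟨le_rfl, zero_le_one⟩, chainFst, chainSnd]
  simp only [sub_zero, one_mul, zero_mul, add_zero, Complex.ofReal_zero, norm_mul]
  rw [mul_lt_mul_iff_right₀ h3]

theorem mem_preimage_end_iff (H : HenonSeq d q δ η) {N : ℕ} (hN : 1 ≤ N) {n : ℕ} (v : Cn 2) :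
    v ∈ chainMap d q δ N n 1 ⁻¹' unitPolydisc 2 ↔
      ‖orbit d q δ (N + n) v 0‖ < chainRadius (n + 1) ∧
      ‖orbit d q δ (N + n + 1) v 0‖ < chainRadius (n + 1) := by
  rw [H.mem_preimage_unitPolydisc_iff hN ⟨zero_le_one, le_rfl⟩, chainFst, chainSnd,
    orbit_succ_zero, add_comm (δ _ * _)]
  simp only [sub_self, one_mul, zero_mul, zero_add, Complex.ofReal_one]

/-- The slope is at least 2/5 - 1/64 > 3/8, as the initial radius carries the factor |δ_{N+n+1}| ≤
1/64. -/
theorem chainSnd_sub_le (H : HenonSeq d q δ η) {N : ℕ} (hN : 1 ≤ N)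
    (hs : 64 * (d + 1) * η N ≤ 1) (n : ℕ) {τ σ : ℝ} (h : τ < σ) :
    chainSnd δ N n τ + (σ - τ) * (3 / 8) ≤ chainSnd δ N n σ := by
  have hn : 1 ≤ N + n := hN.trans (Nat.le_add_right _ _)
  have h1 := le_chainRadius (n + 1)
  have h2 : ‖δ (N + n + 1)‖ ≤ 1 / 64 := by
    have h3 := H.small_add hN hs (n + 1)
    have h4 := H.norm_le (N + n + 1) (Nat.le_add_left 1 _)
    have h5 := H.eta_pos (N + n + 1) (Nat.le_add_left 1 _)
    have h6 : 0 ≤ d * η (N + n + 1) := by positivity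
    rw [← add_assoc] at h3
    linarith
  have h3 : ‖δ (N + n)‖ * chainRadius n ≤ 1 := mul_le_one₀
    ((H.norm_le _ hn).trans (H.eta_lt_one _ hn).le) (by linarith [le_chainRadius n])
    (by linarith [chainRadius_lt n])
  have h4 : ‖δ (N + n + 1)‖ * (‖δ (N + n)‖ * chainRadius n) ≤ 1 / 64 * 1 :=
    mul_le_mul h2 h3 (mul_nonneg (norm_nonneg _) (by linarith [le_chainRadius n])) (by norm_num)
  unfold chainSnd
  nlinarith

theorem polydiscChain (H : HenonSeq d q δ η) {N : ℕ} (hN : 1 ≤ N)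
    (hs : 64 * (d + 1) * η N ≤ 1) : PolydiscChain (chainMap d q δ N) where
  isAut n τ hτ := H.isAut_chainMap hN hτ
  continuousOn n v := by
    have h1 : ContinuousOn (fun τ : ℝ => ((chainFst n τ : ℝ) : ℂ)⁻¹) (Icc 0 1) := by
      refine ContinuousOn.inv₀ (Continuous.continuousOn ?_) fun τ hτ => ?_
      · unfold chainFst
        fun_prop
      · exact_mod_cast (chainFst_pos hτ).ne'
    have h2 : ContinuousOn (fun τ : ℝ => ((chainSnd δ N n τ : ℝ) : ℂ)⁻¹) (Icc 0 1) := by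
      refine ContinuousOn.inv₀ (Continuous.continuousOn ?_) fun τ hτ => ?_
      · unfold chainSnd
        fun_prop
      · exact_mod_cast (H.chainSnd_pos hN hτ).ne'
    refine (PiLp.continuous_toLp 2 _).comp_continuousOn (continuousOn_pi.2 fun i => ?_)
    fin_cases i
    · exact h1.mul continuousOn_const
    · simp only [div_eq_mul_inv]
      exact ((continuousOn_const.mul h2).mul continuousOn_const).add
        ((Complex.continuous_ofReal.continuousOn.mul h2).mul continuousOn_const)
  glue n := by
    ext v
    -- By w_{m+1} = δ_{m+1} z_m, both sides bound z_m and z_{m+1} by the same radius, in opposite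
    -- order.
    rw [H.mem_preimage_end_iff hN, H.mem_preimage_start_iff hN, ← add_assoc, orbit_succ_one,
      norm_mul, mul_lt_mul_iff_right₀ (norm_pos_iff.2 (H.ne_zero _ (Nat.le_add_left 1 _))),
      and_comm]
  subset n τ σ h0 hlt h1 v hv := by
    have hτ : τ ∈ Icc (0 : ℝ) 1 := ⟨h0, hlt.le.trans h1⟩
    have hσ : σ ∈ Icc (0 : ℝ) 1 := ⟨h0.trans hlt.le, h1⟩
    rw [H.mem_preimage_closedUnitPolydisc_iff hN hτ] at hv
    rw [H.mem_preimage_unitPolydisc_iff hN hσ]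
    have hfst : chainFst n τ < chainFst n σ := by
      unfold chainFst
      nlinarith [chainRadius_lt_succ n]
    have hfst' : chainFst n σ ≤ 1 / 2 := by
      unfold chainFst
      nlinarith [chainRadius_lt n, chainRadius_lt (n + 1), hσ.1, hσ.2]
    refine ⟨hv.1.trans_lt hfst, ?_⟩
    set z := orbit d q δ (N + n) v 0
    set w := orbit d q δ (N + n) v 1
    set m := N + n + 1
    have hm : 1 ≤ m := Nat.le_add_left 1 _
    have hP : ‖z ^ d + (q m).eval z‖ ≤ 1 / 3 := by
      have h2 := H.norm_pow_add_eval_le hm (z := z) (b := 1 / 2)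
        (by linarith [hv.1]) le_rfl
      have h3 : 64 * (d + 1) * η m ≤ 1 := H.small_add hN hs (n + 1)
      have h4 := H.eta_pos m hm
      linarith
    -- Passing from τ to σ changes the function by (σ - τ) P(z) with |P(z)| ≤ 1/3, less than the
    -- gain (σ - τ) · 3/8 in radius.
    have heq : δ m * w + σ * (z ^ d + (q m).eval z) =
        (δ m * w + τ * (z ^ d + (q m).eval z)) +
          ((σ - τ : ℝ) : ℂ) * (z ^ d + (q m).eval z) := by
      push_cast
      ring
    rw [heq]
    refine (norm_add_le _ _).trans_lt ?_
    rw [norm_mul, Complex.norm_real, Real.norm_of_nonneg (sub_pos.2 hlt).le]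
    have h5 := H.chainSnd_sub_le hN hs n hlt
    have h6 : (σ - τ) * ‖z ^ d + (q m).eval z‖ ≤ (σ - τ) * (1 / 3) :=
      mul_le_mul_of_nonneg_left hP (sub_pos.2 hlt).le
    linarith [hv.2, sub_pos.2 hlt]

theorem basin_eq_iUnion_chainSet (H : HenonSeq d q δ η) {N : ℕ} (hN : 1 ≤ N)
    (hs : 64 * (d + 1) * η N ≤ 1) : (basin fun n => henonMap d (q n) (δ n)) =
      ⋃ t ∈ Ici (0 : ℝ), chainSet (chainMap d q δ N) t := by
  have hT := H.polydiscChain hN hs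
  ext v
  rw [mem_iUnion₂]
  constructor
  · intro hv
    have h := (tendsto_norm_coord hv 0).eventually_lt_const (show (0 : ℝ) < 2 / 5 by norm_num)
    obtain ⟨M, hM⟩ := eventually_atTop.1 h
    -- At the end of a piece only two consecutive first coordinates are constrained, so no smallness
    -- relative to δ is needed.
    refine ⟨(M : ℝ) + 1, mem_Ici.2 (by positivity), ?_⟩
    rw [hT.chainSet_eq (n := M) (by linarith) le_rfl, add_sub_cancel_left,
      H.mem_preimage_end_iff hN]
    exact ⟨(hM _ (by omega)).trans_le (le_chainRadius _),
      (hM _ (by omega)).trans_le (le_chainRadius _)⟩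
  · rintro ⟨t, ht, hv⟩
    have hlt := Nat.lt_floor_add_one t
    -- Enlarging to the next integer time gives a genuine bidisc of radii below 1/2 in the orbit
    -- coordinates.
    have h1 := hT.closure_subset (mem_Ici.1 ht) hlt (subset_closure hv)
    rw [hT.chainSet_eq (n := ⌊t⌋₊) (by linarith) le_rfl, add_sub_cancel_left, hT.glue,
      H.mem_preimage_start_iff hN] at h1
    set n := ⌊t⌋₊ + 1
    have hn : 1 ≤ N + n := hN.trans (Nat.le_add_right _ _)
    have h2 := chainRadius_lt n
    have h3 : ‖δ (N + n)‖ * chainRadius n ≤ 1 * chainRadius n :=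
      mul_le_mul_of_nonneg_right ((H.norm_le _ hn).trans (H.eta_lt_one _ hn).le)
        (by linarith [le_chainRadius n])
    exact H.mem_basin_of_norm_le hn (H.small_add hN hs n) (by linarith [h1.1])
      (by linarith [h1.2])

theorem isShort_basin (H : HenonSeq d q δ η) :
    IsShort (basin fun n => henonMap d (q n) (δ n)) where
  two_le := le_rfl
  union_balls := H.exists_basin_eq_iUnion_balls
  kobayashi_zero _ hp ξ := H.kobayashiMetric_eq_zero hp ξ
  exists_psh := H.exists_plurisubharmonic

theorem isLoewnerShort_basin (H : HenonSeq d q δ η) :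
    IsLoewnerShort (basin fun n => henonMap d (q n) (δ n)) := by
  obtain ⟨N, hN, hs⟩ := H.exists_eta_le (ε := 1 / (64 * (d + 1))) (by positivity)
  rw [le_div_iff₀' (by positivity)] at hs
  exact (H.polydiscChain hN hs).isLoewnerShort H.isShort_basin (H.basin_eq_iUnion_chainSet hN hs)

end HenonSeq

end LoewnerShort

theorem mainTheorem4 (d : ℕ) (a : ℕ → ℝ) (q : ℕ → Polynomial ℂ) (δ : ℕ → ℂ)
    (ha : ∀ n, 1 ≤ n → 0 < a (n + 1) ∧ a (n + 1) ≤ a n ∧ a n < 1)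
    (hq : ∀ n, 1 ≤ n → 1 ≤ (q n).natDegree ∧ (q n).natDegree ≤ d - 1)
    (hqa : ∀ n, 1 ≤ n → ∀ i, ‖(q n).coeff i‖ ≤ a n ^ d ^ n)
    (hδ : ∀ n, 1 ≤ n → δ n ≠ 0)
    (hδa : ∀ n, 1 ≤ n → ‖δ n‖ ≤ a n ^ d ^ n) :
    LoewnerShort.IsLoewnerShort
      (LoewnerShort.basin (fun n => LoewnerShort.henonMap d (q n) (δ n))) := by
  -- The degree bounds for q_1 already force d ≥ 2, even with truncated subtraction.
  have hd : 2 ≤ d := by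
    have := hq 1 le_rfl
    omega
  have hpos : ∀ n, 1 ≤ n → 0 < a n := fun n hn => (ha n hn).1.trans_le (ha n hn).2.1
  have H : LoewnerShort.HenonSeq d q δ fun n => a n ^ d ^ n :=
    { two_le := hd
      natDegree_lt := fun n hn => by
        have := hq n hn
        omega
      coeff_le := hqa
      ne_zero := hδ
      norm_le := hδa
      eta_pos := fun n hn => pow_pos (hpos n hn) _
      eta_lt_one := fun n hn => pow_lt_one₀ (hpos n hn).le (ha n hn).2.2
        (pow_ne_zero _ (by omega))
      eta_succ := fun n hn => by
        rw [← pow_mul, ← pow_succ]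
        exact pow_le_pow_left₀ (ha n hn).1.le (ha n hn).2.1 _ }
  exact H.isLoewnerShort_basin
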